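/- Fix integers $k_1,k_2\ge 0$, a quantile level $\tau\in(0,1)$ and compact sets $\mathcal A\subset\mathbb R^{k_1}$, $\mathcal B\subset\mathbb R^{k_2}$, $\mathcal F\subset\mathbb R^{k_1\times k_2}$. For sizes $(p_1,p_2,T)$ a parameter is $\theta=(R,F_1,\dots,F_T,C)$ with $R\in\mathbb R^{p_1\times k_1}$ (rows $r_i'$), $F_t\in\mathbb R^{k_1\times k_2}$, $C\in\mathbb R^{p_2\times k_2}$ (rows $c_j'$). The parameter space $\Theta$ consists of all $\theta$ such that $r_i\in\mathcal A$, $c_j\in\mathcal B$, $F_t\in\mathcal F$ for all $i,j,t$; $R'R/p_1=I_{k_1}$, $C'C/p_2=I_{k_2}$; and $\frac1T\sum_tF_tF_t'$ and $\frac1T\sum_tF_t'F_t$ are diagonal with non-increasing diagonal entries. Model. One observes $X_{ijt}=r_{0i}'F_{0t}c_{0j}+\varepsilon_{ijt}$ ($i\le p_1$, $j\le p_2$, $t\le T$), where the loadings $R_0,C_0$ are non-random, the factor matrices $F_0=(F_{01},\dots,F_{0T})$ and the errors are random, and all of these may depend on $(p_1,p_2,T)$. Assume that for all large $p_1,p_2,T$: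 (a) $\theta_0=(R_0,F_{01},\dots,F_{0T},C_0)\in\Theta$ almost surely; (b) $P(\varepsilon_{ijt}\le0\mid F_0)=\tau$ almost surely, for all $i,j,t$; (c) given $F_0$, each $\varepsilon_{ijt}$ has a conditional density $f_{ijt}$, and for every compact $K\subset\mathbb R$ there is a constant $\underline f>0$, depending only on $K$, such that $f_{ijt}(u)\ge\underline f$ for all $u\in K$, all $i,j,t$, all sizes and all values of $F_0$; (d) given $F_0$, the $\varepsilon_{ijt}$ are independent across $i$, $j$ and $t$. Assume moreover that, as $p_1,p_2,T\to\infty$, the diagonal entries of $\frac1T\sum_tF_{0t}F_{0t}'$ converge in probability to constants $\sigma_1>\dots>\sigma_{k_1}>0$, and those of $\frac1T\sum_tF_{0t}'F_{0t}$ to constants $\sigma_1'>\dots>\sigma_{k_2}'>0$. Estimator. Let $\rho_\tau(u)=(\tau-\mathbf 1\{u\le0\})u$ and let $\hat\theta=(\hat R,\hat F_1,\dots,\hat F_T,\hat C)$ be such that, for all large $p_1,p_2,T$, almost surely $\hat\theta$ minimizes $\frac1{p_1p_2T}\sum_{i,j,t}\rho_\tau(X_{ijt}-r_i'F_tc_j)$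 over $\theta\in\Theta$. Since $(R,F_t,C)$ and $(RS_1,S_1F_tS_2,CS_2)$, with $S_1,S_2$ diagonal matrices of signs $\pm1$, have the same common components, signs are aligned with the truth: let $\hat S_1,\hat S_2$ be the diagonal matrices with diagonal entries $\operatorname{sgn}((\hat R'R_0)_{aa})$ and $\operatorname{sgn}((\hat C'C_0)_{bb})$, where $\operatorname{sgn}(x)=1$ for $x\ge0$ and $-1$ for $x<0$. Theorem. With $L_{p_1p_2T}=\min\{\sqrt{p_1p_2},\sqrt{p_2T},\sqrt{p_1T}\}$, as $p_1,p_2,T\to\infty$ jointly, $$\frac{\|\hat R\hat S_1-R_0\|_F}{\sqrt{p_1}}+\frac{\big(\sum_{t=1}^T\|\hat S_1\hat F_t\hat S_2-F_{0t}\|_F^2\big)^{1/2}}{\sqrt T}+\frac{\|\hat C\hat S_2-C_0\|_F}{\sqrt{p_2}}=O_p\Big(\frac1{L_{p_1p_2T}}\Big).$$ In particular, if the signs of $\hat\theta$ are normalized so that the diagonal entries of $\hat R'R_0$ and $\hat C'C_0$ are non-negative, then $$\frac{\|\hat R-R_0\|_F}{\sqrt{p_1}}+\frac{\|\hat F-F_0\|_F}{\sqrt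 T}+\frac{\|\hat C-C_0\|_F}{\sqrt{p_2}}=O_p\Big(\frac1{L_{p_1p_2T}}\Big).$$ (Here $\|\cdot\|_F$ is the Frobenius norm, $F=(F_1,\dots,F_T)$, and $O_p$ is understood in outer probability when $\hat\theta$ is not measurable.) -/

import Mathlib

open MeasureTheory ProbabilityTheory Filter

noncomputable section

namespace MatrixQuantileFactor

/-- A parameter `θ = (R, F₁, …, F_T, C)`: row loadings `R` (with rows `rᵢ'`), factor matrices
`F_t`, column loadings `C` (with rows `cⱼ'`). -/
structure Param (p₁ p₂ T k₁ k₂ : ℕ) where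
  R : Matrix (Fin p₁) (Fin k₁) ℝ
  F : Fin T → Matrix (Fin k₁) (Fin k₂) ℝ
  C : Matrix (Fin p₂) (Fin k₂) ℝ

/-- The common component `rᵢ' F_t cⱼ`, that is, the `(i, j)` entry of `R F_t C'`. -/
def Param.common {p₁ p₂ T k₁ k₂ : ℕ} (θ : Param p₁ p₂ T k₁ k₂)
    (i : Fin p₁) (j : Fin p₂) (t : Fin T) : ℝ :=
  (θ.R * θ.F t * θ.C.transpose) i j

/-- `T⁻¹ ∑ₜ F_t F_t'`. -/
def rowGram {T k₁ k₂ : ℕ} (F : Fin T → Matrix (Fin k₁) (Fin k₂) ℝ) :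
    Matrix (Fin k₁) (Fin k₁) ℝ :=
  (T : ℝ)⁻¹ • ∑ t, F t * (F t).transpose

/-- `T⁻¹ ∑ₜ F_t' F_t`. -/
def colGram {T k₁ k₂ : ℕ} (F : Fin T → Matrix (Fin k₁) (Fin k₂) ℝ) :
    Matrix (Fin k₂) (Fin k₂) ℝ :=
  (T : ℝ)⁻¹ • ∑ t, (F t).transpose * F t

/-- Diagonal with non-increasing diagonal entries. -/
def IsDiagDescending {k : ℕ} (A : Matrix (Fin k) (Fin k) ℝ) : Prop :=
  A.IsDiag ∧ Antitone fun j => A j j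

/-- The parameter space: `rᵢ ∈ 𝓐`, `cⱼ ∈ 𝓑`, `F_t ∈ 𝓕`, with the normalizations
`R'R/p₁ = I`, `C'C/p₂ = I`, and both second moment matrices of the factors diagonal with
non-increasing diagonal entries. -/
def paramSpace {k₁ k₂ : ℕ} (𝓐 : Set (Fin k₁ → ℝ)) (𝓑 : Set (Fin k₂ → ℝ))
    (𝓕 : Set (Matrix (Fin k₁) (Fin k₂) ℝ)) (p₁ p₂ T : ℕ) : Set (Param p₁ p₂ T k₁ k₂) :=
  {θ | (∀ i, θ.R i ∈ 𝓐) ∧ (∀ j, θ.C j ∈ 𝓑) ∧ (∀ t, θ.F t ∈ 𝓕) ∧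
    (p₁ : ℝ)⁻¹ • (θ.R.transpose * θ.R) = 1 ∧
    (p₂ : ℝ)⁻¹ • (θ.C.transpose * θ.C) = 1 ∧
    IsDiagDescending (rowGram θ.F) ∧ IsDiagDescending (colGram θ.F)}

/-- The check function `ρ_τ(u) = (τ - 1{u ≤ 0}) u`. -/
def checkLoss (τ u : ℝ) : ℝ := (τ - if u ≤ 0 then 1 else 0) * u

/-- The empirical check loss `(p₁ p₂ T)⁻¹ ∑ᵢⱼₜ ρ_τ(X_{ijt} - rᵢ' F_t cⱼ)`. -/
def empiricalLoss (τ : ℝ) {p₁ p₂ T k₁ k₂ : ℕ} (X : Fin p₁ × Fin p₂ × Fin T → ℝ)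
    (θ : Param p₁ p₂ T k₁ k₂) : ℝ :=
  ((p₁ : ℝ) * p₂ * T)⁻¹ * ∑ i, ∑ j, ∑ t, checkLoss τ (X (i, j, t) - θ.common i j t)

/-- The ingredients of a matrix quantile factor model on a probability space `Ω`, for all sizes
`p₁, p₂, T`: non-random loadings, random factor matrices and random idiosyncratic errors. Since
the normalizations depend on the sizes, all of them may depend on `(p₁, p₂, T)`. -/
structure Model (Ω : Type*) (k₁ k₂ : ℕ) where
  R₀ : ∀ p₁ _p₂ _T : ℕ, Matrix (Fin p₁) (Fin k₁) ℝ
  C₀ : ∀ _p₁ p₂ _T : ℕ, Matrix (Fin p₂) (Fin k₂) ℝ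
  F₀ : ∀ _p₁ _p₂ T : ℕ, Ω → Fin T → Fin k₁ → Fin k₂ → ℝ
  ε : ∀ p₁ p₂ T : ℕ, Ω → Fin p₁ × Fin p₂ × Fin T → ℝ

namespace Model

variable {Ω : Type*} {k₁ k₂ : ℕ}

/-- The true parameter `θ₀`. -/
def θ₀ (M : Model Ω k₁ k₂) (p₁ p₂ T : ℕ) (ω : Ω) : Param p₁ p₂ T k₁ k₂ where
  R := M.R₀ p₁ p₂ T
  F := fun t => Matrix.of (M.F₀ p₁ p₂ T ω t)
  C := M.C₀ p₁ p₂ T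

/-- The observations `X_{ijt} = r₀ᵢ' F₀ₜ c₀ⱼ + ε_{ijt}`. -/
def X (M : Model Ω k₁ k₂) (p₁ p₂ T : ℕ) (ω : Ω) : Fin p₁ × Fin p₂ × Fin T → ℝ :=
  fun x => (M.θ₀ p₁ p₂ T ω).common x.1 x.2.1 x.2.2 + M.ε p₁ p₂ T ω x

/-- The standing conditions on the model at quantile level `τ`. Conditioning is on the whole
factor sequence `F₀ = (F₀₁, …, F₀_T)`, through regular conditional distributions. Conditions for
fixed sizes are imposed for all large `p₁, p₂, T` only, because `R'R/p₁ = I` has no solution when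
`p₁ < k₁`. -/
structure Regular [MeasurableSpace Ω] (M : Model Ω k₁ k₂) (P : Measure Ω) [IsProbabilityMeasure P]
    (τ : ℝ) (𝓐 : Set (Fin k₁ → ℝ)) (𝓑 : Set (Fin k₂ → ℝ))
    (𝓕 : Set (Matrix (Fin k₁) (Fin k₂) ℝ)) : Prop where
  isCompact_row : IsCompact 𝓐
  isCompact_col : IsCompact 𝓑
  isCompact_factor : IsCompact 𝓕
  measurable_factor : ∀ᶠ n : ℕ × ℕ × ℕ in atTop, Measurable (M.F₀ n.1 n.2.1 n.2.2)
  measurable_error : ∀ᶠ n : ℕ × ℕ × ℕ in atTop, Measurable (M.ε n.1 n.2.1 n.2.2)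
  true_mem : ∀ᶠ n : ℕ × ℕ × ℕ in atTop, ∀ᵐ ω ∂P,
    M.θ₀ n.1 n.2.1 n.2.2 ω ∈ paramSpace 𝓐 𝓑 𝓕 n.1 n.2.1 n.2.2
  /-- `σ_{T,j} → σⱼ` in probability with `σ₁ > ⋯ > σ_{k₁} > 0`. -/
  row_spectrum : ∃ σ : Fin k₁ → ℝ, StrictAnti σ ∧ (∀ a, 0 < σ a) ∧ ∀ a,
    TendstoInMeasure P
      (fun (n : ℕ × ℕ × ℕ) ω => rowGram (M.θ₀ n.1 n.2.1 n.2.2 ω).F a a) atTop (fun _ => σ a)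
  /-- `σ'_{T,j} → σ'ⱼ` in probability with `σ'₁ > ⋯ > σ'_{k₂} > 0`. -/
  col_spectrum : ∃ σ' : Fin k₂ → ℝ, StrictAnti σ' ∧ (∀ b, 0 < σ' b) ∧ ∀ b,
    TendstoInMeasure P
      (fun (n : ℕ × ℕ × ℕ) ω => colGram (M.θ₀ n.1 n.2.1 n.2.2 ω).F b b) atTop (fun _ => σ' b)
  /-- Given the factors, the `τ`-quantile of each error is zero. -/
  quantile : ∀ᶠ n : ℕ × ℕ × ℕ in atTop, ∀ x,
    ∀ᵐ F ∂(P.map (M.F₀ n.1 n.2.1 n.2.2)),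
      condDistrib (fun ω => M.ε n.1 n.2.1 n.2.2 ω x) (M.F₀ n.1 n.2.1 n.2.2) P F (Set.Iic 0)
        = ENNReal.ofReal τ
  /-- Given the factors, each error has a density `f_{ijt}(· | F₀)`, and these densities are
  bounded away from zero on every compact set, uniformly in everything else. -/
  density : ∃ f : ∀ p₁ p₂ T : ℕ, Fin p₁ × Fin p₂ × Fin T →
      (Fin T → Fin k₁ → Fin k₂ → ℝ) → ℝ → ℝ,
    (∀ p₁ p₂ T x F, Measurable (f p₁ p₂ T x F)) ∧
    (∀ᶠ n : ℕ × ℕ × ℕ in atTop, ∀ x, ∀ᵐ F ∂(P.map (M.F₀ n.1 n.2.1 n.2.2)),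
      condDistrib (fun ω => M.ε n.1 n.2.1 n.2.2 ω x) (M.F₀ n.1 n.2.1 n.2.2) P F
        = volume.withDensity fun u => ENNReal.ofReal (f n.1 n.2.1 n.2.2 x F u)) ∧
    ∀ K : Set ℝ, IsCompact K → ∃ c : ℝ, 0 < c ∧
      ∀ p₁ p₂ T x F, ∀ u ∈ K, c ≤ f p₁ p₂ T x F u
  /-- Given the factors, the errors are independent across `i`, `j` and `t`: their joint
  conditional law is the product of the individual conditional laws. -/
  indep : ∀ᶠ n : ℕ × ℕ × ℕ in atTop, ∀ᵐ F ∂(P.map (M.F₀ n.1 n.2.1 n.2.2)),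
    condDistrib (M.ε n.1 n.2.1 n.2.2) (M.F₀ n.1 n.2.1 n.2.2) P F
      = Measure.pi fun x =>
          condDistrib (fun ω => M.ε n.1 n.2.1 n.2.2 ω x) (M.F₀ n.1 n.2.1 n.2.2) P F

/-- `θhat` is a quantile regression estimator: for all large sizes, almost surely, it minimizes
the empirical check loss over the parameter space. -/
def IsQREstimator [MeasurableSpace Ω] (M : Model Ω k₁ k₂) (P : Measure Ω) (τ : ℝ)
    (𝓐 : Set (Fin k₁ → ℝ)) (𝓑 : Set (Fin k₂ → ℝ)) (𝓕 : Set (Matrix (Fin k₁) (Fin k₂) ℝ))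
    (θhat : ∀ p₁ p₂ T : ℕ, Ω → Param p₁ p₂ T k₁ k₂) : Prop :=
  ∀ᶠ n : ℕ × ℕ × ℕ in atTop, ∀ᵐ ω ∂P,
    θhat n.1 n.2.1 n.2.2 ω ∈ paramSpace 𝓐 𝓑 𝓕 n.1 n.2.1 n.2.2 ∧
    ∀ θ ∈ paramSpace 𝓐 𝓑 𝓕 n.1 n.2.1 n.2.2,
      empiricalLoss τ (M.X n.1 n.2.1 n.2.2 ω) (θhat n.1 n.2.1 n.2.2 ω)
        ≤ empiricalLoss τ (M.X n.1 n.2.1 n.2.2 ω) θ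

end Model

/-- The squared Frobenius norm. -/
def frobSq {m n : ℕ} (A : Matrix (Fin m) (Fin n) ℝ) : ℝ := ∑ i, ∑ j, A i j ^ 2

/-- The diagonal sign matrix `diag(sgn((A'B)₁₁), …, sgn((A'B)ₖₖ))` with `sgn(0) = 1`, which
aligns the signs of the columns of `A` with those of `B`. -/
def signAlign {p k : ℕ} (A B : Matrix (Fin p) (Fin k) ℝ) : Matrix (Fin k) (Fin k) ℝ :=
  Matrix.diagonal fun a => if 0 ≤ (A.transpose * B) a a then 1 else -1

/-- The parameter `(R S₁, S₁ F_t S₂, C S₂)`, where `S₁` and `S₂` align the column signs of the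
loadings of `θ` with those of `θ₀`. It has the same common components as `θ`. -/
def Param.align {p₁ p₂ T k₁ k₂ : ℕ} (θ θ₀ : Param p₁ p₂ T k₁ k₂) : Param p₁ p₂ T k₁ k₂ where
  R := θ.R * signAlign θ.R θ₀.R
  F := fun t => signAlign θ.R θ₀.R * θ.F t * signAlign θ.C θ₀.C
  C := θ.C * signAlign θ.C θ₀.C

/-- `‖R - R₀‖_F/√p₁ + ‖F - F₀‖_F/√T + ‖C - C₀‖_F/√p₂`, with `F = (F₁, …, F_T)`. -/
def Param.error {p₁ p₂ T k₁ k₂ : ℕ} (θ θ₀ : Param p₁ p₂ T k₁ k₂) : ℝ :=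
  √(frobSq (θ.R - θ₀.R)) / √(p₁ : ℝ)
    + √(∑ t, frobSq (θ.F t - θ₀.F t)) / √(T : ℝ)
    + √(frobSq (θ.C - θ₀.C)) / √(p₂ : ℝ)

/-- `L = min(√(p₁p₂), √(p₂T), √(p₁T))`. -/
def rateL (p₁ p₂ T : ℕ) : ℝ :=
  min (√((p₁ : ℝ) * p₂)) (min (√((p₂ : ℝ) * T)) (√((p₁ : ℝ) * T)))

/-- `Y = O_p(a)` as `p₁, p₂, T → ∞` jointly. (For sets that need not be measurable, `P` is the
outer probability.) -/
def IsBigOP {Ω : Type*} [MeasurableSpace Ω] (P : Measure Ω) (Y : ℕ → ℕ → ℕ → Ω → ℝ)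
    (a : ℕ → ℕ → ℕ → ℝ) : Prop :=
  ∀ η : ℝ, 0 < η → ∃ K : ℝ, ∀ᶠ n : ℕ × ℕ × ℕ in atTop,
    P {ω | K * a n.1 n.2.1 n.2.2 < |Y n.1 n.2.1 n.2.2 ω|} ≤ ENNReal.ofReal η

end MatrixQuantileFactor

end

/-! Let Δ be the tensor of estimated minus true common components, of size `p₁ × p₂ × T`. The proof
bounds ‖Δ‖ by an M-estimation argument and then passes from Δ to the parameters by linear algebra.

Optimality of the estimator makes the total excess loss at Δ nonpositive. For any fixed bounded
perturbation, the mean excess given `F₀` is at least a constant times its squared norm, since zero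
is the τ-quantile and the error densities are bounded below on compact sets (`le_integral_excess`).
Hence ‖Δ‖² is controlled by the supremum of a centred empirical process. Symmetrization and
contraction (`integral_iSup_sum_excess_le`) replace it by the pairing of perturbations with a tensor
of random signs. Differences of common components have mode-one and mode-two ranks at most `2k₁` and
`2k₂`, so the pairing is at most 2√(k₁k₂) times their norm times the spectral norm of the sign
tensor (`LowRank.sum_mul_le`), whose mean is O(√(p₁ + p₂ + T)) by a net argument
(`exists_spectralBound`). Convexity of the loss on rays lets everything happen on a sphere of one
radius K√(p₁ + p₂ + T) (`exists_rescale`), so neither peeling nor prior consistency is needed. The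
mean square of Δ is therefore of order (p₁ + p₂ + T)/(p₁p₂T), which is O(1/L²).

For the parameters, the normalizations make the loadings eigenvectors: summing M_t M_t' over the
common matrices M_t gives a multiple of R G R', with G the diagonal row Gram matrix of the factors.
The limiting spectrum is simple and positive, so with high probability the true Gram matrix has an
eigengap, and eigenvectors are Lipschitz in the matrix up to sign (`one_sub_abs_overlap_le`).
Transposition treats the column loadings, and F_t is recovered linearly from M_t and the loadings
(`error_align_le`). -/

namespace MatrixQuantileFactor

/-! ### Identification: from common components to sign-aligned parameters. -/

section Identification

open scoped Matrix Matrix.Norms.Frobenius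

theorem frobSq_eq_norm_sq {m n : ℕ} (A : Matrix (Fin m) (Fin n) ℝ) : frobSq A = ‖A‖ ^ 2 := by
  rw [Matrix.frobenius_norm_def, ← Real.rpow_natCast, ← Real.rpow_mul (by positivity)]
  simp [frobSq]

theorem sqrt_frobSq {m n : ℕ} (A : Matrix (Fin m) (Fin n) ℝ) : √(frobSq A) = ‖A‖ := by
  rw [frobSq_eq_norm_sq, Real.sqrt_sq (norm_nonneg _)]

theorem abs_apply_le_norm {m n : ℕ} (A : Matrix (Fin m) (Fin n) ℝ) (i : Fin m) (j : Fin n) :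
    |A i j| ≤ ‖A‖ := by
  rw [← sqrt_frobSq]
  apply Real.abs_le_sqrt
  calc A i j ^ 2 ≤ ∑ j, A i j ^ 2 :=
        Finset.single_le_sum (f := fun j => A i j ^ 2) (fun _ _ => sq_nonneg _) (Finset.mem_univ j)
    _ ≤ frobSq A := Finset.single_le_sum (f := fun i => ∑ j, A i j ^ 2)
        (fun _ _ => Finset.sum_nonneg fun _ _ => sq_nonneg _) (Finset.mem_univ i)

theorem transpose_mul_self_apply {m n : ℕ} (A : Matrix (Fin m) (Fin n) ℝ) (b : Fin n) :
    (Aᵀ * A) b b = ∑ i, A i b ^ 2 := by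
  simp [Matrix.mul_apply, sq]

theorem frobSq_eq_sum_transpose_mul_self {m n : ℕ} (A : Matrix (Fin m) (Fin n) ℝ) :
    frobSq A = ∑ b, (Aᵀ * A) b b := by
  simp_rw [transpose_mul_self_apply]
  exact Finset.sum_comm

theorem norm_sq_of_orthonormal {p k : ℕ} {Q : Matrix (Fin p) (Fin k) ℝ} (hQ : Qᵀ * Q = 1) :
    ‖Q‖ ^ 2 = k := by
  rw [← frobSq_eq_norm_sq, frobSq_eq_sum_transpose_mul_self, hQ]
  simp

theorem transpose_mul_self_apply_le {m n : ℕ} (A : Matrix (Fin m) (Fin n) ℝ) (b : Fin n) :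
    (Aᵀ * A) b b ≤ ‖A‖ ^ 2 := by
  rw [← frobSq_eq_norm_sq, frobSq_eq_sum_transpose_mul_self]
  refine Finset.single_le_sum (f := fun b => (Aᵀ * A) b b) (fun b _ => ?_) (Finset.mem_univ b)
  rw [transpose_mul_self_apply]
  exact Finset.sum_nonneg fun _ _ => sq_nonneg _

/-- The part of `Q₀` orthogonal to `Q` has Gram matrix `1 - H'H`, where `H = Q'Q₀`. -/
theorem residual_gram {p k : ℕ} {Q Q₀ : Matrix (Fin p) (Fin k) ℝ} (hQ : Qᵀ * Q = 1)
    (hQ₀ : Q₀ᵀ * Q₀ = 1) :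
    (Q₀ - Q * (Qᵀ * Q₀))ᵀ * (Q₀ - Q * (Qᵀ * Q₀)) = 1 - (Qᵀ * Q₀)ᵀ * (Qᵀ * Q₀) := by
  have e : Qᵀ * (Q₀ - Q * (Qᵀ * Q₀)) = 0 := by
    rw [Matrix.mul_sub, ← Matrix.mul_assoc Qᵀ Q, hQ, Matrix.one_mul, sub_self]
  conv_lhs => rw [Matrix.transpose_sub, Matrix.sub_mul, Matrix.transpose_mul Q, Matrix.mul_assoc,
    e, Matrix.mul_zero, sub_zero, Matrix.mul_sub, hQ₀, ← Matrix.mul_assoc]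
  simp [Matrix.transpose_mul]

theorem sum_overlap_sq_le_one {p k : ℕ} {Q Q₀ : Matrix (Fin p) (Fin k) ℝ} (hQ : Qᵀ * Q = 1)
    (hQ₀ : Q₀ᵀ * Q₀ = 1) (b : Fin k) : ∑ a, (Qᵀ * Q₀) a b ^ 2 ≤ 1 := by
  have h := congrFun (congrFun (residual_gram hQ hQ₀) b) b
  rw [transpose_mul_self_apply, Matrix.sub_apply, transpose_mul_self_apply,
    Matrix.one_apply_eq] at h
  have : 0 ≤ ∑ i, (Q₀ - Q * (Qᵀ * Q₀)) i b ^ 2 := Finset.sum_nonneg fun _ _ => sq_nonneg _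
  linarith

/-- A quantitative eigenvector perturbation bound: if two spectral decompositions are at Frobenius
distance at most `κ` and the second has eigengap `g`, then matching eigenvectors have inner product
`1 - O(κ²)` in absolute value. -/
theorem one_sub_abs_overlap_le {p k : ℕ} {Q Q₀ : Matrix (Fin p) (Fin k) ℝ} (hQ : Qᵀ * Q = 1)
    (hQ₀ : Q₀ᵀ * Q₀ = 1) {s s₀ : Fin k → ℝ} (hs : Antitone s) {g κ : ℝ} (hg : 0 < g)
    (hgap : ∀ a b, a < b → s₀ b + g ≤ s₀ a) (hpos : ∀ a, g ≤ s₀ a)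
    (hZ : ‖Q * Matrix.diagonal s * Qᵀ - Q₀ * Matrix.diagonal s₀ * Q₀ᵀ‖ ≤ κ) (b : Fin k) :
    1 - |(Qᵀ * Q₀) b b| ≤ 8 * k ^ 3 * κ ^ 2 / g ^ 2 := by
  have hκ : 0 ≤ κ := (norm_nonneg _).trans hZ
  have hk : (1 : ℝ) ≤ k := by
    have := b.pos
    exact_mod_cast this
  -- Outside this range the right-hand side is at least 1 and there is nothing to prove.
  by_cases hsmall : 8 * (k : ℝ) ^ 3 * κ ^ 2 < g ^ 2
  swap
  · have : 1 ≤ 8 * (k : ℝ) ^ 3 * κ ^ 2 / g ^ 2 := by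
      rw [le_div_iff₀ (by positivity)]
      linarith
    linarith [abs_nonneg ((Qᵀ * Q₀) b b)]
  set Z := Q * Matrix.diagonal s * Qᵀ - Q₀ * Matrix.diagonal s₀ * Q₀ᵀ with hZdef
  set H := Qᵀ * Q₀ with hH
  have nQ := norm_sq_of_orthonormal hQ
  have nQ₀ := norm_sq_of_orthonormal hQ₀
  have ZQ₀ : Z * Q₀ = Q * Matrix.diagonal s * H - Q₀ * Matrix.diagonal s₀ := by
    rw [hZdef, Matrix.sub_mul, Matrix.mul_assoc _ Qᵀ, Matrix.mul_assoc _ Q₀ᵀ, hQ₀, Matrix.mul_one]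
  -- In the two eigenbases the perturbation is a Sylvester expression in `H`, so each overlap is
  -- damped by the difference of its two eigenvalues.
  have QZQ₀ : Qᵀ * (Z * Q₀) = Matrix.diagonal s * H - H * Matrix.diagonal s₀ := by
    rw [ZQ₀, Matrix.mul_sub, Matrix.mul_assoc Q, ← Matrix.mul_assoc Qᵀ Q, hQ, Matrix.one_mul,
      ← Matrix.mul_assoc Qᵀ Q₀]
  have nZQ₀ : ‖Z * Q₀‖ ≤ κ * ‖Q₀‖ :=
    (Matrix.frobenius_norm_mul _ _).trans (by gcongr)
  have nQQ₀ : ‖Q‖ = ‖Q₀‖ := by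
    rw [← Real.sqrt_sq (norm_nonneg Q), ← Real.sqrt_sq (norm_nonneg Q₀), nQ, nQ₀]
  have nQZQ₀ : ‖Qᵀ * (Z * Q₀)‖ ≤ k * κ := by
    refine (Matrix.frobenius_norm_mul _ _).trans ?_
    rw [Matrix.frobenius_norm_transpose, nQQ₀]
    calc ‖Q₀‖ * ‖Z * Q₀‖ ≤ ‖Q₀‖ * (κ * ‖Q₀‖) := by gcongr
      _ = ‖Q₀‖ ^ 2 * κ := by ring
      _ = k * κ := by rw [nQ₀]
  have entry : ∀ a b, |(s a - s₀ b) * H a b| ≤ k * κ := by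
    intro a b
    have : (Qᵀ * (Z * Q₀)) a b = (s a - s₀ b) * H a b := by
      rw [QZQ₀, Matrix.sub_apply, Matrix.diagonal_mul, Matrix.mul_diagonal]; ring
    rw [← this]
    exact (abs_apply_le_norm _ _ _).trans nQZQ₀
  have resid : ∀ b, g ^ 2 * (1 - ∑ a, H a b ^ 2) ≤ 4 * k ^ 3 * κ ^ 2 := by
    intro b
    set Y := Q₀ - Q * H with hY
    -- The component of `Q₀` outside the range of `Q` sees only the perturbation, because the first
    -- decomposition vanishes there; dividing by `s₀ b ≥ g` bounds it.
    have eY : Y * Matrix.diagonal s₀ = Q * (Qᵀ * (Z * Q₀)) - Z * Q₀ := by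
      rw [QZQ₀, ZQ₀, hY, Matrix.mul_sub, Matrix.sub_mul]
      simp only [Matrix.mul_assoc]
      abel
    have nY : ‖Y * Matrix.diagonal s₀‖ ≤ 2 * k * κ * ‖Q₀‖ := by
      rw [eY]
      calc _ ≤ ‖Q * (Qᵀ * (Z * Q₀))‖ + ‖Z * Q₀‖ := norm_sub_le _ _
        _ ≤ ‖Q‖ * (k * κ) + κ * ‖Q₀‖ := by
          gcongr
          exact (Matrix.frobenius_norm_mul _ _).trans (by gcongr)
        _ ≤ 2 * k * κ * ‖Q₀‖ := by
          rw [nQQ₀]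
          have : 0 ≤ κ * ‖Q₀‖ := by positivity
          nlinarith
    have h1 := transpose_mul_self_apply_le (Y * Matrix.diagonal s₀) b
    have h2 : ((Y * Matrix.diagonal s₀)ᵀ * (Y * Matrix.diagonal s₀)) b b
        = s₀ b ^ 2 * (1 - ∑ a, H a b ^ 2) := by
      have := congrFun (congrFun (residual_gram hQ hQ₀) b) b
      rw [transpose_mul_self_apply, Matrix.sub_apply, transpose_mul_self_apply,
        Matrix.one_apply_eq] at this
      rw [← this, transpose_mul_self_apply, Finset.mul_sum]
      simp [Matrix.mul_diagonal, mul_pow, mul_comm, hY, hH]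
    rw [h2] at h1
    have h3 : 0 ≤ 1 - ∑ a, H a b ^ 2 := by linarith [sum_overlap_sq_le_one hQ hQ₀ b]
    calc g ^ 2 * (1 - ∑ a, H a b ^ 2) ≤ s₀ b ^ 2 * (1 - ∑ a, H a b ^ 2) := by
          gcongr; exact hpos b
      _ ≤ (2 * k * κ * ‖Q₀‖) ^ 2 := h1.trans (by gcongr)
      _ = 4 * k ^ 2 * κ ^ 2 * ‖Q₀‖ ^ 2 := by ring
      _ = 4 * k ^ 3 * κ ^ 2 := by rw [nQ₀]; ring
  -- By `resid`, each column of `H` keeps squared mass above 1/2, so one of its `k` entries has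
  -- square at least 1/(2k).
  have large : ∀ b, ∃ a, 1 / 2 ≤ k * H a b ^ 2 := by
    intro b
    by_contra! hcon
    have h1 : ∑ a, (k : ℝ) * H a b ^ 2 < ∑ _a : Fin k, (1 / 2 : ℝ) :=
      Finset.sum_lt_sum_of_nonempty ⟨b, Finset.mem_univ b⟩ fun a _ => hcon a
    rw [← Finset.mul_sum] at h1
    simp only [Finset.sum_const, Finset.card_univ, Fintype.card_fin, nsmul_eq_mul] at h1
    have h2 : ∑ a, H a b ^ 2 < 1 / 2 := lt_of_mul_lt_mul_left h1 (by positivity)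
    have h3 := resid b
    nlinarith [sq_nonneg g, mul_pos hg hg]
  choose π hπ using large
  have close : ∀ b, |s (π b) - s₀ b| < g / 2 := by
    intro b
    apply abs_lt_of_sq_lt_sq _ (by positivity)
    have h1 := entry (π b) b
    have h2 : ((s (π b) - s₀ b) * H (π b) b) ^ 2 ≤ (k * κ) ^ 2 := sq_le_sq' (by
      linarith [neg_abs_le ((s (π b) - s₀ b) * H (π b) b)]) ((le_abs_self _).trans h1)
    have h3 := mul_le_mul_of_nonneg_left (hπ b) (sq_nonneg (s (π b) - s₀ b))
    have h4 : (s (π b) - s₀ b) ^ 2 * (k * H (π b) b ^ 2) ≤ k ^ 3 * κ ^ 2 := by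
      calc _ = k * ((s (π b) - s₀ b) * H (π b) b) ^ 2 := by ring
        _ ≤ k * (k * κ) ^ 2 := by gcongr
        _ = _ := by ring
    nlinarith
  -- The eigenvalues chosen by `π` follow those of `s₀` to within half a gap, so `π` preserves the
  -- strict order; a strictly monotone self-map of `Fin k` is the identity.
  have mono : StrictMono π := by
    intro b b' hb
    by_contra! hcon
    have h1 := hs hcon
    have h2 := abs_lt.1 (close b)
    have h3 := abs_lt.1 (close b')
    have h4 := hgap b b' hb
    linarith [h2.1, h3.2]
  have hid : ∀ b, π b = b :=
    fun b => le_antisymm mono.apply_le mono.le_apply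
  have off : ∀ a, a ≠ b → H a b ^ 2 ≤ 4 * k ^ 2 * κ ^ 2 / g ^ 2 := by
    intro a hab
    have h1 : g / 2 ≤ |s a - s₀ b| := by
      have h2 := abs_lt.1 (close a)
      rw [hid] at h2
      rcases lt_or_gt_of_ne hab with h | h
      · have := hgap _ _ h
        exact le_trans (by linarith [h2.1]) (le_abs_self _)
      · have := hgap _ _ h
        exact le_trans (by linarith [h2.2]) (neg_le_abs _)
    have h3 := entry a b
    rw [abs_mul] at h3
    have h4 : g / 2 * |H a b| ≤ k * κ :=
      le_trans (mul_le_mul_of_nonneg_right h1 (abs_nonneg _)) h3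
    rw [le_div_iff₀ (by positivity), ← sq_abs]
    have h5 : (g / 2 * |H a b|) ^ 2 ≤ (k * κ) ^ 2 := by gcongr
    nlinarith
  have hsum : ∑ a, H a b ^ 2 ≤ H b b ^ 2 + k * (4 * k ^ 2 * κ ^ 2 / g ^ 2) := by
    rw [← Finset.add_sum_erase _ _ (Finset.mem_univ b)]
    gcongr
    calc ∑ a ∈ Finset.univ.erase b, H a b ^ 2
        ≤ ∑ _a ∈ Finset.univ.erase b, 4 * k ^ 2 * κ ^ 2 / g ^ 2 :=
          Finset.sum_le_sum fun a ha => off a (Finset.ne_of_mem_erase ha)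
      _ ≤ ∑ _a : Fin k, 4 * k ^ 2 * κ ^ 2 / g ^ 2 :=
          Finset.sum_le_sum_of_subset_of_nonneg (Finset.erase_subset _ _)
            fun _ _ _ => by positivity
      _ = _ := by simp
  have h1 : |H b b| ≤ 1 := by
    rw [← sq_le_one_iff_abs_le_one]
    exact (Finset.single_le_sum (f := fun a => H a b ^ 2) (fun _ _ => sq_nonneg _)
      (Finset.mem_univ b)).trans (sum_overlap_sq_le_one hQ hQ₀ b)
  have h2 : H b b ^ 2 ≤ |H b b| := by
    rw [← sq_abs]; nlinarith [abs_nonneg (H b b)]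
  have h3 : 1 - ∑ a, H a b ^ 2 ≤ 4 * k ^ 3 * κ ^ 2 / g ^ 2 := by
    rw [le_div_iff₀ (by positivity)]; linarith [resid b]
  have h4 : k * (4 * k ^ 2 * κ ^ 2 / g ^ 2) + 4 * k ^ 3 * κ ^ 2 / g ^ 2
      = 8 * k ^ 3 * κ ^ 2 / g ^ 2 := by ring
  linarith

/-- Each pair of columns has squared length `p`, so expanding the square leaves only the cross term,
which the sign alignment turns into an absolute value. An overlap deficit of order κ² thus becomes a
loading error of order κ. -/
theorem norm_mul_signAlign_sub_sq {p k : ℕ} (hp : 0 < p) {R R₀ : Matrix (Fin p) (Fin k) ℝ}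
    (hR : (p : ℝ)⁻¹ • (Rᵀ * R) = 1) (hR₀ : (p : ℝ)⁻¹ • (R₀ᵀ * R₀) = 1) :
    ‖R * signAlign R R₀ - R₀‖ ^ 2 = ∑ b, 2 * (p - |(Rᵀ * R₀) b b|) := by
  have hp' : (p : ℝ) ≠ 0 := by positivity
  have diag : ∀ {A : Matrix (Fin p) (Fin k) ℝ}, (p : ℝ)⁻¹ • (Aᵀ * A) = 1 →
      ∀ b, ∑ i, A i b ^ 2 = p := by
    intro A hA b
    have h := congrFun (congrFun hA b) b
    rw [Matrix.smul_apply, transpose_mul_self_apply, Matrix.one_apply_eq, smul_eq_mul] at h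
    field_simp at h
    exact h
  rw [← frobSq_eq_norm_sq, frobSq, Finset.sum_comm]
  refine Finset.sum_congr rfl fun b _ => ?_
  set σ : ℝ := if 0 ≤ (Rᵀ * R₀) b b then 1 else -1 with hσ
  have hσ2 : σ ^ 2 = 1 := by rw [hσ]; split_ifs <;> norm_num
  have hσa : σ * (Rᵀ * R₀) b b = |(Rᵀ * R₀) b b| := by
    rw [hσ]; split_ifs with h
    · rw [abs_of_nonneg h, one_mul]
    · rw [abs_of_neg (not_le.1 h)]; ring
  calc ∑ i, (R * signAlign R R₀ - R₀) i b ^ 2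
      = ∑ i, (σ ^ 2 * R i b ^ 2 + R₀ i b ^ 2 - 2 * (σ * (R i b * R₀ i b))) := by
        refine Finset.sum_congr rfl fun i _ => ?_
        rw [signAlign, Matrix.sub_apply, Matrix.mul_diagonal, ← hσ]
        ring
    _ = σ ^ 2 * ∑ i, R i b ^ 2 + ∑ i, R₀ i b ^ 2 - 2 * (σ * (Rᵀ * R₀) b b) := by
        rw [Finset.sum_sub_distrib, Finset.sum_add_distrib, ← Finset.mul_sum, ← Finset.mul_sum,
          ← Finset.mul_sum, Matrix.mul_apply]
        simp
    _ = _ := by rw [hσ2, hσa, diag hR, diag hR₀]; ring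

theorem normalized_gram {p k : ℕ} {R : Matrix (Fin p) (Fin k) ℝ}
    (hR : (p : ℝ)⁻¹ • (Rᵀ * R) = 1) : ((√p)⁻¹ • R)ᵀ * ((√p)⁻¹ • R) = 1 := by
  rw [Matrix.transpose_smul, Matrix.smul_mul, Matrix.mul_smul, smul_smul, ← mul_inv,
    Real.mul_self_sqrt (by positivity), hR]

theorem norm_sq_of_normalized {p k : ℕ} (hp : 0 < p) {R : Matrix (Fin p) (Fin k) ℝ}
    (hR : (p : ℝ)⁻¹ • (Rᵀ * R) = 1) : ‖R‖ ^ 2 = k * p := by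
  have h := norm_sq_of_orthonormal (normalized_gram hR)
  have hp' : (0 : ℝ) < p := by exact_mod_cast hp
  rw [norm_smul, mul_pow, norm_inv, inv_pow, Real.norm_of_nonneg (Real.sqrt_nonneg _),
    Real.sq_sqrt hp'.le] at h
  field_simp at h
  linarith

/-- Sign-aligned loadings are close when the low-rank matrices they span are. -/
theorem norm_mul_signAlign_sub_sq_le {p k : ℕ} (hp : 0 < p) {R R₀ : Matrix (Fin p) (Fin k) ℝ}
    (hR : (p : ℝ)⁻¹ • (Rᵀ * R) = 1) (hR₀ : (p : ℝ)⁻¹ • (R₀ᵀ * R₀) = 1)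
    {s s₀ : Fin k → ℝ} (hs : Antitone s) {g κ : ℝ} (hg : 0 < g)
    (hgap : ∀ a b, a < b → s₀ b + g ≤ s₀ a) (hpos : ∀ a, g ≤ s₀ a)
    (hZ : ‖R * Matrix.diagonal s * Rᵀ - R₀ * Matrix.diagonal s₀ * R₀ᵀ‖ ≤ p * κ) :
    ‖R * signAlign R R₀ - R₀‖ ^ 2 ≤ p * (16 * k ^ 4 * κ ^ 2 / g ^ 2) := by
  have hp' : (0 : ℝ) < p := by exact_mod_cast hp
  have hsq : (√(p : ℝ))⁻¹ * (√(p : ℝ))⁻¹ = (p : ℝ)⁻¹ := by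
    rw [← mul_inv, Real.mul_self_sqrt hp'.le]
  have scale : ∀ (A : Matrix (Fin p) (Fin k) ℝ) (D : Matrix (Fin k) (Fin k) ℝ),
      ((√p)⁻¹ • A) * D * ((√p)⁻¹ • A)ᵀ = (p : ℝ)⁻¹ • (A * D * Aᵀ) := by
    intro A D
    rw [Matrix.transpose_smul, Matrix.smul_mul, Matrix.smul_mul, Matrix.mul_smul, smul_smul, hsq]
  have key := one_sub_abs_overlap_le (normalized_gram hR) (normalized_gram hR₀) hs hg hgap hpos
    (κ := κ) (by
      rw [scale, scale, ← smul_sub, norm_smul, norm_inv, Real.norm_of_nonneg hp'.le,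
        inv_mul_le_iff₀ hp']
      exact hZ)
  rw [norm_mul_signAlign_sub_sq hp hR hR₀]
  calc ∑ b, 2 * (p - |(Rᵀ * R₀) b b|) ≤ ∑ _b : Fin k, 2 * (p * (8 * k ^ 3 * κ ^ 2 / g ^ 2)) := by
        refine Finset.sum_le_sum fun b _ => ?_
        have h := key b
        rw [Matrix.transpose_smul, Matrix.smul_mul, Matrix.mul_smul, smul_smul, hsq,
          Matrix.smul_apply, smul_eq_mul, abs_mul, abs_inv, abs_of_pos hp'] at h
        have h2 := mul_le_mul_of_nonneg_left h hp'.le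
        rw [mul_sub, mul_one, mul_inv_cancel_left₀ hp'.ne'] at h2
        linarith
    _ = _ := by
        simp only [Finset.sum_const, Finset.card_univ, Fintype.card_fin, nsmul_eq_mul]
        ring

/-- The orthonormality of `C` removes the column loadings, leaving a spectral decomposition whose
eigenvectors are the columns of `R`. -/
theorem sum_common_mul_transpose {p₁ p₂ T k₁ k₂ : ℕ} (hp₂ : 0 < p₂) (hT : 0 < T)
    (R : Matrix (Fin p₁) (Fin k₁) ℝ) (F : Fin T → Matrix (Fin k₁) (Fin k₂) ℝ)
    {C : Matrix (Fin p₂) (Fin k₂) ℝ} (hC : (p₂ : ℝ)⁻¹ • (Cᵀ * C) = 1) :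
    ∑ t, (R * F t * Cᵀ) * (R * F t * Cᵀ)ᵀ = ((p₂ : ℝ) * T) • (R * rowGram F * Rᵀ) := by
  have hCC : Cᵀ * C = (p₂ : ℝ) • (1 : Matrix (Fin k₂) (Fin k₂) ℝ) := by
    rw [← hC, smul_smul, mul_inv_cancel₀ (by positivity), one_smul]
  have h : ∀ t, (R * F t * Cᵀ) * (R * F t * Cᵀ)ᵀ = (p₂ : ℝ) • (R * (F t * (F t)ᵀ) * Rᵀ) := by
    intro t
    have : (R * F t * Cᵀ) * (R * F t * Cᵀ)ᵀ = R * F t * (Cᵀ * C) * (F t)ᵀ * Rᵀ := by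
      simp only [Matrix.transpose_mul, Matrix.transpose_transpose, Matrix.mul_assoc]
    rw [this, hCC]
    simp only [Matrix.mul_smul, Matrix.smul_mul, Matrix.mul_one, Matrix.mul_assoc]
  have hT' : (T : ℝ) ≠ 0 := by positivity
  simp_rw [h]
  rw [rowGram, ← Finset.smul_sum, Matrix.mul_smul, Matrix.smul_mul, smul_smul,
    mul_assoc, mul_inv_cancel₀ hT', mul_one, Matrix.mul_sum, Matrix.sum_mul]

theorem norm_sum_gram_sub_le {p₁ p₂ T : ℕ} (M M₀ : Fin T → Matrix (Fin p₁) (Fin p₂) ℝ)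
    {b : ℝ} (hM : ∀ t, ‖M t‖ ≤ b) (hM₀ : ∀ t, ‖M₀ t‖ ≤ b) :
    ‖∑ t, M t * (M t)ᵀ - ∑ t, M₀ t * (M₀ t)ᵀ‖ ≤ 2 * b * (√T * √(∑ t, ‖M t - M₀ t‖ ^ 2)) := by
  rw [← Finset.sum_sub_distrib]
  calc _ ≤ ∑ t, ‖M t * (M t)ᵀ - M₀ t * (M₀ t)ᵀ‖ := norm_sum_le _ _
    -- The factor 1 prepares the Cauchy–Schwarz inequality over `t`.
    _ ≤ ∑ t, 2 * b * (1 * ‖M t - M₀ t‖) := by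
      refine Finset.sum_le_sum fun t _ => ?_
      have : M t * (M t)ᵀ - M₀ t * (M₀ t)ᵀ
          = (M t - M₀ t) * (M t)ᵀ + M₀ t * (M t - M₀ t)ᵀ := by
        rw [Matrix.transpose_sub, Matrix.sub_mul, Matrix.mul_sub]; abel
      rw [this]
      calc _ ≤ ‖M t - M₀ t‖ * ‖(M t)ᵀ‖ + ‖M₀ t‖ * ‖(M t - M₀ t)ᵀ‖ :=
            (norm_add_le _ _).trans
              (add_le_add (Matrix.frobenius_norm_mul _ _) (Matrix.frobenius_norm_mul _ _))
        _ ≤ ‖M t - M₀ t‖ * b + b * ‖M t - M₀ t‖ := by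
          rw [Matrix.frobenius_norm_transpose, Matrix.frobenius_norm_transpose]
          gcongr
          exacts [hM t, hM₀ t]
        _ = _ := by ring
    _ ≤ _ := by
      rw [← Finset.mul_sum]
      rcases Nat.eq_zero_or_pos T with h | h
      · subst h; simp
      have hb : 0 ≤ b := (norm_nonneg _).trans (hM ⟨0, h⟩)
      gcongr
      have := Real.sum_mul_le_sqrt_mul_sqrt Finset.univ (fun _ : Fin T => (1 : ℝ))
        fun t => ‖M t - M₀ t‖
      simpa using this

theorem row_loading_error {p₁ p₂ T k₁ k₂ : ℕ} (hp₁ : 0 < p₁) (hp₂ : 0 < p₂) (hT : 0 < T)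
    {R R₀ : Matrix (Fin p₁) (Fin k₁) ℝ} {F F₀ : Fin T → Matrix (Fin k₁) (Fin k₂) ℝ}
    {C C₀ : Matrix (Fin p₂) (Fin k₂) ℝ}
    (hR : (p₁ : ℝ)⁻¹ • (Rᵀ * R) = 1) (hR₀ : (p₁ : ℝ)⁻¹ • (R₀ᵀ * R₀) = 1)
    (hC : (p₂ : ℝ)⁻¹ • (Cᵀ * C) = 1) (hC₀ : (p₂ : ℝ)⁻¹ • (C₀ᵀ * C₀) = 1)
    (hF : IsDiagDescending (rowGram F)) (hF₀ : IsDiagDescending (rowGram F₀)) {g B d : ℝ}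
    (hg : 0 < g) (hB0 : 0 ≤ B) (hd : 0 ≤ d)
    (hgap : ∀ a b, a < b → rowGram F₀ b b + g ≤ rowGram F₀ a a)
    (hpos : ∀ a, g ≤ rowGram F₀ a a)
    (hB : ∀ t, ‖R * F t * Cᵀ‖ ≤ B * √(p₁ * p₂)) (hB₀ : ∀ t, ‖R₀ * F₀ t * C₀ᵀ‖ ≤ B * √(p₁ * p₂))
    (hD : ∑ t, ‖R * F t * Cᵀ - R₀ * F₀ t * C₀ᵀ‖ ^ 2 ≤ p₁ * p₂ * T * d ^ 2) :
    ‖R * signAlign R R₀ - R₀‖ ≤ √p₁ * (8 * k₁ ^ 2 * B / g * d) := by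
  have hp₁' : (0 : ℝ) < p₁ := by exact_mod_cast hp₁
  have hp₂' : (0 : ℝ) < p₂ := by exact_mod_cast hp₂
  have hT' : (0 : ℝ) < T := by exact_mod_cast hT
  have h1 := norm_sum_gram_sub_le _ _ hB hB₀
  rw [sum_common_mul_transpose hp₂ hT R F hC, sum_common_mul_transpose hp₂ hT R₀ F₀ hC₀,
    ← smul_sub, norm_smul, Real.norm_of_nonneg (by positivity),
    ← hF.1.diagonal_diag, ← hF₀.1.diagonal_diag] at h1
  have h2 : √(∑ t, ‖R * F t * Cᵀ - R₀ * F₀ t * C₀ᵀ‖ ^ 2) ≤ √(p₁ * p₂) * √T * d := by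
    rw [← Real.sqrt_sq hd, ← Real.sqrt_mul (by positivity), ← Real.sqrt_mul (by positivity)]
    exact Real.sqrt_le_sqrt hD
  -- This is the perturbation bound with κ = 2Bd; then 16k₁⁴κ²/g² is the square of 8k₁²Bd/g.
  have h3 : 2 * (B * √(p₁ * p₂)) * (√T * √(∑ t, ‖R * F t * Cᵀ - R₀ * F₀ t * C₀ᵀ‖ ^ 2))
      ≤ (p₂ * T) * (p₁ * (2 * B * d)) := by
    calc _ ≤ 2 * (B * √(p₁ * p₂)) * (√T * (√(p₁ * p₂) * √T * d)) := by gcongr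
      _ = 2 * B * (√(p₁ * p₂) * √(p₁ * p₂)) * (√T * √T) * d := by ring
      _ = _ := by
        rw [Real.mul_self_sqrt (by positivity), Real.mul_self_sqrt (by positivity)]; ring
  have h4 := le_of_mul_le_mul_left (h1.trans h3) (by positivity)
  have h5 := norm_mul_signAlign_sub_sq_le hp₁ hR hR₀ hF.2 hg hgap hpos h4
  refine le_of_sq_le_sq (h5.trans (le_of_eq ?_)) (by positivity)
  rw [mul_pow (√(p₁ : ℝ)), Real.sq_sqrt hp₁'.le]
  ring

theorem rowGram_transpose {T k₁ k₂ : ℕ} (F : Fin T → Matrix (Fin k₁) (Fin k₂) ℝ) :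
    rowGram (fun t => (F t)ᵀ) = colGram F := by
  simp [rowGram, colGram]

/-- The factors are a linear function of the common matrix once the loadings are known, so their
error needs no further spectral argument. -/
theorem factor_eq {p₁ p₂ k₁ k₂ : ℕ} (hp₁ : 0 < p₁) (hp₂ : 0 < p₂)
    {R : Matrix (Fin p₁) (Fin k₁) ℝ} (F : Matrix (Fin k₁) (Fin k₂) ℝ)
    {C : Matrix (Fin p₂) (Fin k₂) ℝ}
    (hR : (p₁ : ℝ)⁻¹ • (Rᵀ * R) = 1) (hC : (p₂ : ℝ)⁻¹ • (Cᵀ * C) = 1) :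
    Rᵀ * (R * F * Cᵀ) * C = ((p₁ : ℝ) * p₂) • F := by
  have hRR : Rᵀ * R = (p₁ : ℝ) • (1 : Matrix (Fin k₁) (Fin k₁) ℝ) := by
    rw [← hR, smul_smul, mul_inv_cancel₀ (by positivity), one_smul]
  have hCC : Cᵀ * C = (p₂ : ℝ) • (1 : Matrix (Fin k₂) (Fin k₂) ℝ) := by
    rw [← hC, smul_smul, mul_inv_cancel₀ (by positivity), one_smul]
  have : Rᵀ * (R * F * Cᵀ) * C = (Rᵀ * R) * F * (Cᵀ * C) := by simp only [Matrix.mul_assoc]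
  rw [this, hRR, hCC]
  simp [smul_smul, mul_comm]

theorem signAlign_transpose {p k : ℕ} (A B : Matrix (Fin p) (Fin k) ℝ) :
    (signAlign A B)ᵀ = signAlign A B := by
  simp [signAlign]

theorem signAlign_mul_self {p k : ℕ} (A B : Matrix (Fin p) (Fin k) ℝ) :
    signAlign A B * signAlign A B = 1 := by
  rw [signAlign, Matrix.diagonal_mul_diagonal, ← Matrix.diagonal_one]
  congr 1
  funext a
  split_ifs <;> norm_num

theorem normalized_mul_signAlign {p k : ℕ} {R : Matrix (Fin p) (Fin k) ℝ}
    (hR : (p : ℝ)⁻¹ • (Rᵀ * R) = 1) (A B : Matrix (Fin p) (Fin k) ℝ) :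
    (p : ℝ)⁻¹ • ((R * signAlign A B)ᵀ * (R * signAlign A B)) = 1 := by
  rw [Matrix.transpose_mul, signAlign_transpose, Matrix.mul_assoc, ← Matrix.mul_assoc Rᵀ,
    ← Matrix.mul_smul, ← Matrix.smul_mul, hR, Matrix.one_mul, signAlign_mul_self]

theorem align_common_matrix {p₁ p₂ T k₁ k₂ : ℕ} (θ θ₀ : Param p₁ p₂ T k₁ k₂) (t : Fin T) :
    (θ.align θ₀).R * (θ.align θ₀).F t * (θ.align θ₀).Cᵀ = θ.R * θ.F t * θ.Cᵀ := by
  simp only [Param.align, Matrix.transpose_mul, signAlign_transpose]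
  calc _ = θ.R * (signAlign θ.R θ₀.R * signAlign θ.R θ₀.R) * θ.F t
        * (signAlign θ.C θ₀.C * signAlign θ.C θ₀.C) * θ.Cᵀ := by simp only [Matrix.mul_assoc]
    _ = _ := by rw [signAlign_mul_self, signAlign_mul_self, Matrix.mul_one, Matrix.mul_one]

theorem factor_error {p₁ p₂ T k₁ k₂ : ℕ} (hp₁ : 0 < p₁) (hp₂ : 0 < p₂)
    {R R₀ : Matrix (Fin p₁) (Fin k₁) ℝ} {F F₀ : Fin T → Matrix (Fin k₁) (Fin k₂) ℝ}
    {C C₀ : Matrix (Fin p₂) (Fin k₂) ℝ}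
    (hR : (p₁ : ℝ)⁻¹ • (Rᵀ * R) = 1) (hR₀ : (p₁ : ℝ)⁻¹ • (R₀ᵀ * R₀) = 1)
    (hC : (p₂ : ℝ)⁻¹ • (Cᵀ * C) = 1) (hC₀ : (p₂ : ℝ)⁻¹ • (C₀ᵀ * C₀) = 1) {B d a c : ℝ}
    (hB : ∀ t, ‖R * F t * Cᵀ‖ ≤ B * √(p₁ * p₂)) (hB₀ : ∀ t, ‖R₀ * F₀ t * C₀ᵀ‖ ≤ B * √(p₁ * p₂))
    (hD : ∑ t, ‖R * F t * Cᵀ - R₀ * F₀ t * C₀ᵀ‖ ^ 2 ≤ p₁ * p₂ * T * d ^ 2)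
    (ha : ‖R - R₀‖ ≤ √p₁ * a) (hc : ‖C - C₀‖ ≤ √p₂ * c) :
    ∑ t, ‖F t - F₀ t‖ ^ 2
      ≤ T * (3 * (k₂ * B ^ 2 * a ^ 2 + k₁ * k₂ * d ^ 2 + k₁ * B ^ 2 * c ^ 2)) := by
  have hp₁' : (0 : ℝ) < p₁ := by exact_mod_cast hp₁
  have hp₂' : (0 : ℝ) < p₂ := by exact_mod_cast hp₂
  have ha2 : ‖R - R₀‖ ^ 2 ≤ p₁ * a ^ 2 := by
    calc _ ≤ (√p₁ * a) ^ 2 := by gcongr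
      _ = _ := by rw [mul_pow, Real.sq_sqrt hp₁'.le]
  have hc2 : ‖C - C₀‖ ^ 2 ≤ p₂ * c ^ 2 := by
    calc _ ≤ (√p₂ * c) ^ 2 := by gcongr
      _ = _ := by rw [mul_pow, Real.sq_sqrt hp₂'.le]
  have sqB : ∀ x : ℝ, 0 ≤ x → x ≤ B * √(p₁ * p₂) → x ^ 2 ≤ B ^ 2 * (p₁ * p₂) := by
    intro x hx h
    calc x ^ 2 ≤ (B * √(p₁ * p₂)) ^ 2 := by gcongr
      _ = _ := by rw [mul_pow, Real.sq_sqrt (by positivity)]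
  have nC := norm_sq_of_normalized hp₂ hC
  have nR₀ := norm_sq_of_normalized hp₁ hR₀
  have tri : ∀ x y z : ℝ, (x + y + z) ^ 2 ≤ 3 * (x ^ 2 + y ^ 2 + z ^ 2) := fun x y z => by
    nlinarith [sq_nonneg (x - y), sq_nonneg (y - z), sq_nonneg (x - z)]
  have each : ∀ t, p₁ * p₂ * ‖F t - F₀ t‖ ^ 2 ≤ 3 * (k₂ * B ^ 2 * a ^ 2 * (p₁ * p₂)
      + k₁ * k₂ * ‖R * F t * Cᵀ - R₀ * F₀ t * C₀ᵀ‖ ^ 2 + k₁ * B ^ 2 * c ^ 2 * (p₁ * p₂)) := by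
    intro t
    set M := R * F t * Cᵀ with hM
    set M₀ := R₀ * F₀ t * C₀ᵀ with hM₀
    -- Telescoping R'MC − R₀'M₀C₀ by changing one of the three factors at a time.
    have e : ((p₁ : ℝ) * p₂) • (F t - F₀ t)
        = (R - R₀)ᵀ * M * C + R₀ᵀ * (M - M₀) * C + R₀ᵀ * M₀ * (C - C₀) := by
      rw [smul_sub, ← factor_eq hp₁ hp₂ (F t) hR hC, ← factor_eq hp₁ hp₂ (F₀ t) hR₀ hC₀, ← hM,
        ← hM₀]
      simp only [Matrix.transpose_sub, Matrix.sub_mul, Matrix.mul_sub]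
      abel
    have mul3 : ∀ {a b c d : ℕ} (X : Matrix (Fin b) (Fin a) ℝ) (Y : Matrix (Fin b) (Fin c) ℝ)
        (Z : Matrix (Fin c) (Fin d) ℝ), ‖Xᵀ * Y * Z‖ ≤ ‖X‖ * ‖Y‖ * ‖Z‖ := by
      intro a b c d X Y Z
      refine (Matrix.frobenius_norm_mul _ _).trans ?_
      gcongr
      refine (Matrix.frobenius_norm_mul _ _).trans ?_
      rw [Matrix.frobenius_norm_transpose]
    have h1 : (p₁ * p₂) * ‖F t - F₀ t‖
        ≤ ‖R - R₀‖ * ‖M‖ * ‖C‖ + ‖R₀‖ * ‖M - M₀‖ * ‖C‖ + ‖R₀‖ * ‖M₀‖ * ‖C - C₀‖ := by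
      have := congrArg norm e
      rw [norm_smul, Real.norm_of_nonneg (by positivity)] at this
      rw [this]
      refine (norm_add_le _ _).trans (add_le_add ((norm_add_le _ _).trans (add_le_add ?_ ?_)) ?_)
      all_goals exact mul3 _ _ _
    have h2 : (p₁ * p₂) * (p₁ * p₂ * ‖F t - F₀ t‖ ^ 2) ≤ (p₁ * p₂) *
        (3 * (k₂ * B ^ 2 * a ^ 2 * (p₁ * p₂) + k₁ * k₂ * ‖M - M₀‖ ^ 2
          + k₁ * B ^ 2 * c ^ 2 * (p₁ * p₂))) := by
      calc _ = ((p₁ * p₂) * ‖F t - F₀ t‖) ^ 2 := by ring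
        _ ≤ (‖R - R₀‖ * ‖M‖ * ‖C‖ + ‖R₀‖ * ‖M - M₀‖ * ‖C‖ + ‖R₀‖ * ‖M₀‖ * ‖C - C₀‖) ^ 2 := by
          gcongr
        _ ≤ 3 * (‖R - R₀‖ ^ 2 * ‖M‖ ^ 2 * ‖C‖ ^ 2 + ‖R₀‖ ^ 2 * ‖M - M₀‖ ^ 2 * ‖C‖ ^ 2
            + ‖R₀‖ ^ 2 * ‖M₀‖ ^ 2 * ‖C - C₀‖ ^ 2) := by
          refine (tri _ _ _).trans (le_of_eq ?_); ring
        _ ≤ 3 * ((p₁ * a ^ 2) * (B ^ 2 * (p₁ * p₂)) * (k₂ * p₂)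
            + (k₁ * p₁) * ‖M - M₀‖ ^ 2 * (k₂ * p₂)
            + (k₁ * p₁) * (B ^ 2 * (p₁ * p₂)) * (p₂ * c ^ 2)) := by
          rw [nC, nR₀]
          gcongr
          · exact sqB _ (norm_nonneg _) (hB t)
          · exact sqB _ (norm_nonneg _) (hB₀ t)
        _ = _ := by ring
    exact le_of_mul_le_mul_left h2 (by positivity)
  have hs := Finset.sum_le_sum fun t (_ : t ∈ Finset.univ) => each t
  rw [← Finset.mul_sum, ← Finset.mul_sum, Finset.sum_add_distrib, Finset.sum_add_distrib,
    ← Finset.mul_sum] at hs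
  simp only [Finset.sum_const, Finset.card_univ, Fintype.card_fin, nsmul_eq_mul] at hs
  have h3 : k₁ * k₂ * ∑ t, ‖R * F t * Cᵀ - R₀ * F₀ t * C₀ᵀ‖ ^ 2
      ≤ (k₁ * k₂ : ℝ) * (p₁ * p₂ * T * d ^ 2) := by gcongr
  rw [Finset.mul_sum] at h3
  refine le_of_mul_le_mul_left (a := (p₁ * p₂ : ℝ)) (hs.trans ?_) (by positivity)
  linarith

/-- The constant in the bound of the parameter error by the error of the common components. -/
noncomputable def errorConst (k₁ k₂ : ℕ) (B g : ℝ) : ℝ :=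
  8 * k₁ ^ 2 * B / g + √(3 * (k₂ * B ^ 2 * (8 * k₁ ^ 2 * B / g) ^ 2 + k₁ * k₂
    + k₁ * B ^ 2 * (8 * k₂ ^ 2 * B / g) ^ 2)) + 8 * k₂ ^ 2 * B / g

theorem norm_common_le {p₁ p₂ T k₁ k₂ : ℕ} {θ : Param p₁ p₂ T k₁ k₂} {B : ℝ} (hB0 : 0 ≤ B)
    (hB : ∀ i j t, |θ.common i j t| ≤ B) (t : Fin T) :
    ‖θ.R * θ.F t * θ.Cᵀ‖ ≤ B * √(p₁ * p₂) := by
  rw [← sqrt_frobSq, ← Real.sqrt_sq hB0, ← Real.sqrt_mul (sq_nonneg _)]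
  apply Real.sqrt_le_sqrt
  calc frobSq _ ≤ ∑ _i : Fin p₁, ∑ _j : Fin p₂, B ^ 2 :=
        Finset.sum_le_sum fun i _ => Finset.sum_le_sum fun j _ =>
          sq_le_sq' (abs_le.1 (hB i j t)).1 (abs_le.1 (hB i j t)).2
    _ = _ := by simp; ring

/-- Identification: the aligned parameter error is at most a constant times the root mean square
error of the common components. -/
theorem error_align_le {p₁ p₂ T k₁ k₂ : ℕ} (hp₁ : 0 < p₁) (hp₂ : 0 < p₂) (hT : 0 < T)
    {𝓐 : Set (Fin k₁ → ℝ)} {𝓑 : Set (Fin k₂ → ℝ)} {𝓕 : Set (Matrix (Fin k₁) (Fin k₂) ℝ)}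
    {θ θ₀ : Param p₁ p₂ T k₁ k₂} (hθ : θ ∈ paramSpace 𝓐 𝓑 𝓕 p₁ p₂ T)
    (hθ₀ : θ₀ ∈ paramSpace 𝓐 𝓑 𝓕 p₁ p₂ T) {g B d : ℝ} (hg : 0 < g) (hB0 : 0 ≤ B) (hd : 0 ≤ d)
    (hgap : ∀ a b, a < b → rowGram θ₀.F b b + g ≤ rowGram θ₀.F a a)
    (hpos : ∀ a, g ≤ rowGram θ₀.F a a)
    (hgap' : ∀ a b, a < b → colGram θ₀.F b b + g ≤ colGram θ₀.F a a)
    (hpos' : ∀ a, g ≤ colGram θ₀.F a a)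
    (hB : ∀ i j t, |θ.common i j t| ≤ B) (hB₀ : ∀ i j t, |θ₀.common i j t| ≤ B)
    (hD : ∑ x : Fin p₁ × Fin p₂ × Fin T,
      (θ.common x.1 x.2.1 x.2.2 - θ₀.common x.1 x.2.1 x.2.2) ^ 2 ≤ p₁ * p₂ * T * d ^ 2) :
    (θ.align θ₀).error θ₀ ≤ errorConst k₁ k₂ B g * d := by
  have hp₁' : (0 : ℝ) < p₁ := by exact_mod_cast hp₁
  have hp₂' : (0 : ℝ) < p₂ := by exact_mod_cast hp₂
  have hT' : (0 : ℝ) < T := by exact_mod_cast hT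
  obtain ⟨-, -, -, hR, hC, hF, hF'⟩ := hθ
  obtain ⟨-, -, -, hR₀, hC₀, hF₀, hF₀'⟩ := hθ₀
  have hM := norm_common_le hB0 hB
  have hM₀ := norm_common_le hB0 hB₀
  have hD' : ∑ t, ‖θ.R * θ.F t * θ.Cᵀ - θ₀.R * θ₀.F t * θ₀.Cᵀ‖ ^ 2 ≤ p₁ * p₂ * T * d ^ 2 := by
    refine le_trans (le_of_eq ?_) hD
    rw [Fintype.sum_prod_type]
    simp_rw [Fintype.sum_prod_type, ← frobSq_eq_norm_sq, frobSq]
    rw [Finset.sum_comm]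
    refine Finset.sum_congr rfl fun i _ => ?_
    rw [Finset.sum_comm]
    rfl
  have swap : ∀ (θ : Param p₁ p₂ T k₁ k₂) t,
      θ.C * (θ.F t)ᵀ * θ.Rᵀ = (θ.R * θ.F t * θ.Cᵀ)ᵀ := by
    intro θ t
    simp only [Matrix.transpose_mul, Matrix.transpose_transpose, Matrix.mul_assoc]
  have eR := row_loading_error hp₁ hp₂ hT hR hR₀ hC hC₀ hF hF₀ hg hB0 hd hgap hpos hM hM₀ hD'
  -- Transposing every `F t` exchanges the roles of rows and columns.
  have eC := row_loading_error (F := fun t => (θ.F t)ᵀ) (F₀ := fun t => (θ₀.F t)ᵀ)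
    hp₂ hp₁ hT hC hC₀ hR hR₀ (by rwa [rowGram_transpose]) (by rwa [rowGram_transpose]) hg hB0 hd
    (by rwa [rowGram_transpose]) (by rwa [rowGram_transpose])
    (fun t => by rw [swap, Matrix.frobenius_norm_transpose, mul_comm (p₂ : ℝ)]; exact hM t)
    (fun t => by rw [swap, Matrix.frobenius_norm_transpose, mul_comm (p₂ : ℝ)]; exact hM₀ t)
    (by
      simp_rw [swap, ← Matrix.transpose_sub, Matrix.frobenius_norm_transpose]
      rwa [mul_comm (p₂ : ℝ)])
  have eF := factor_error (R := (θ.align θ₀).R) (F := (θ.align θ₀).F) (C := (θ.align θ₀).C)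
    hp₁ hp₂ (normalized_mul_signAlign hR _ _) hR₀ (normalized_mul_signAlign hC _ _) hC₀
    (fun t => by rw [align_common_matrix]; exact hM t) hM₀
    (by simp_rw [align_common_matrix]; exact hD') eR eC
  unfold Param.error errorConst
  simp_rw [frobSq_eq_norm_sq, Real.sqrt_sq (norm_nonneg _)]
  rw [add_mul, add_mul]
  gcongr
  · rw [div_le_iff₀ (by positivity), mul_comm _ (√(p₁ : ℝ))]
    exact eR
  · rw [div_le_iff₀ (by positivity), ← Real.sqrt_sq hd, ← Real.sqrt_mul (by positivity),
      ← Real.sqrt_mul (by positivity)]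
    refine Real.sqrt_le_sqrt (eF.trans (le_of_eq ?_))
    ring
  · rw [div_le_iff₀ (by positivity), mul_comm _ (√(p₂ : ℝ))]
    exact eC

end Identification

/-! ### Duality between low-rank tensors and the spectral norm. -/

/-- `b` bounds the spectral norm of the tensor `s`. -/
def SpectralBound {α β γ : Type*} [Fintype α] [Fintype β] [Fintype γ] (s : α × β × γ → ℝ)
    (b : ℝ) : Prop :=
  ∀ (u : α → ℝ) (v : β → ℝ) (w : γ → ℝ), ∑ x, s x * (u x.1 * v x.2.1 * w x.2.2)
    ≤ b * (√(∑ i, u i ^ 2) * √(∑ j, v j ^ 2) * √(∑ t, w t ^ 2))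

/-- Mode-one and mode-two fibres of `D` lie in subspaces of dimension at most `m` and `n`. -/
def LowRank {α β γ : Type*} [Fintype α] [Fintype β] (m n : ℕ) (D : α × β × γ → ℝ) : Prop :=
  (∃ W : Submodule ℝ (EuclideanSpace ℝ α), Module.finrank ℝ W ≤ m ∧
    ∀ j t, WithLp.toLp 2 (fun i => D (i, j, t)) ∈ W) ∧
  ∃ W : Submodule ℝ (EuclideanSpace ℝ β), Module.finrank ℝ W ≤ n ∧
    ∀ i t, WithLp.toLp 2 (fun j => D (i, j, t)) ∈ W

/-- Orthonormal bases in explicit sums: reconstruction and Parseval's identity for vectors of `W`.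
-/
theorem exists_orthonormal_coordinates {α : Type*} [Fintype α]
    (W : Submodule ℝ (EuclideanSpace ℝ α)) :
    ∃ u : Fin (Module.finrank ℝ W) → α → ℝ, (∀ a, ∑ i, u a i ^ 2 = 1) ∧
      ∀ z : α → ℝ, WithLp.toLp 2 z ∈ W →
        (∀ i, z i = ∑ a, (∑ i', u a i' * z i') * u a i) ∧
        ∑ a, (∑ i, u a i * z i) ^ 2 = ∑ i, z i ^ 2 := by
  let e := stdOrthonormalBasis ℝ W
  have inner_eq : ∀ a (z : α → ℝ) (hz : WithLp.toLp 2 z ∈ W),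
      inner ℝ (e a) (⟨WithLp.toLp 2 z, hz⟩ : W) = ∑ i, (e a : EuclideanSpace ℝ α) i * z i := by
    intro a z hz
    rw [Submodule.coe_inner, PiLp.inner_apply]
    exact Finset.sum_congr rfl fun i _ => by simp [mul_comm]
  refine ⟨fun a i => (e a : EuclideanSpace ℝ α) i, fun a => ?_, fun z hz => ⟨fun i => ?_, ?_⟩⟩
  · have h := e.orthonormal.1 a
    rw [Submodule.coe_norm, EuclideanSpace.norm_eq, Real.sqrt_eq_one] at h
    simpa using h
  · have h := congrArg (fun y : W => (y : EuclideanSpace ℝ α) i) (e.sum_repr' ⟨_, hz⟩)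
    simp only [inner_eq] at h
    simpa using h.symm
  · have h := e.sum_sq_norm_inner_right ⟨_, hz⟩
    simp only [inner_eq] at h
    rw [Submodule.coe_norm, EuclideanSpace.norm_eq, Real.sq_sqrt (by positivity)] at h
    simpa using h

/-- Orthonormal coordinates in modes one and two write `D` as a sum of at most `m * n` elementary
tensors u_a ⊗ v_c ⊗ g_ac, the third factor being arbitrary. The spectral bound applies to each term,
Parseval gives ∑‖g_ac‖² = ‖D‖², and Cauchy–Schwarz over the pairs (a, c) costs √(mn). No rank
condition in the third mode is needed. -/
theorem LowRank.sum_mul_le {α β γ : Type*} [Fintype α] [Fintype β] [Fintype γ] {m n : ℕ}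
    {D : α × β × γ → ℝ} (hD : LowRank m n D) {s : α × β × γ → ℝ} {b : ℝ} (hb : 0 ≤ b)
    (hs : SpectralBound s b) :
    ∑ x, s x * D x ≤ √(m * n) * √(∑ x, D x ^ 2) * b := by
  obtain ⟨⟨W₁, hm, hW₁⟩, W₂, hn, hW₂⟩ := hD
  obtain ⟨u, hu, hz⟩ := exists_orthonormal_coordinates W₁
  obtain ⟨v, hv, hy⟩ := exists_orthonormal_coordinates W₂
  set h : Fin (Module.finrank ℝ W₁) → β → γ → ℝ := fun a j t => ∑ i, u a i * D (i, j, t) with hh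
  set g : Fin (Module.finrank ℝ W₁) → Fin (Module.finrank ℝ W₂) → γ → ℝ :=
    fun a c t => ∑ j, v c j * h a j t with hg
  have hmem : ∀ a t, WithLp.toLp 2 (fun j => h a j t) ∈ W₂ := by
    intro a t
    have : WithLp.toLp 2 (fun j => h a j t)
        = ∑ i, u a i • (WithLp.toLp 2 (fun j => D (i, j, t)) : EuclideanSpace ℝ β) := by
      ext j
      simp [hh]
    rw [this]
    exact Submodule.sum_mem _ fun i _ => Submodule.smul_mem _ _ (hW₂ i t)
  have expand : ∀ i j t, D (i, j, t) = ∑ a, ∑ c, u a i * v c j * g a c t := by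
    intro i j t
    rw [(hz _ (hW₁ j t)).1 i]
    refine Finset.sum_congr rfl fun a _ => ?_
    change h a j t * u a i = _
    rw [(hy _ (hmem a t)).1 j, Finset.sum_mul]
    exact Finset.sum_congr rfl fun c _ => by ring
  have pars : ∑ a, ∑ c, ∑ t, g a c t ^ 2 = ∑ x, D x ^ 2 := by
    have h1 : ∀ a, ∑ c, ∑ t, g a c t ^ 2 = ∑ j, ∑ t, h a j t ^ 2 := by
      intro a
      rw [Finset.sum_comm, Finset.sum_comm (f := fun j t => h a j t ^ 2)]
      exact Finset.sum_congr rfl fun t _ => (hy _ (hmem a t)).2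
    simp_rw [h1, Fintype.sum_prod_type]
    rw [Finset.sum_comm, Finset.sum_comm (f := fun i j => ∑ t, D (i, j, t) ^ 2)]
    refine Finset.sum_congr rfl fun j _ => ?_
    rw [Finset.sum_comm, Finset.sum_comm (f := fun i t => D (i, j, t) ^ 2)]
    exact Finset.sum_congr rfl fun t _ => (hz _ (hW₁ j t)).2
  calc ∑ x, s x * D x = ∑ a, ∑ c, ∑ x, s x * (u a x.1 * v c x.2.1 * g a c x.2.2) := by
        have : ∀ x, s x * D x = ∑ a, ∑ c, s x * (u a x.1 * v c x.2.1 * g a c x.2.2) := by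
          rintro ⟨i, j, t⟩
          rw [expand, Finset.mul_sum]
          exact Finset.sum_congr rfl fun a _ => Finset.mul_sum _ _ _
        simp_rw [this]
        rw [Finset.sum_comm]
        exact Finset.sum_congr rfl fun a _ => Finset.sum_comm
    _ ≤ ∑ a, ∑ c, b * √(∑ t, g a c t ^ 2) := by
        refine Finset.sum_le_sum fun a _ => Finset.sum_le_sum fun c _ => ?_
        have := hs (u a) (v c) (g a c)
        rwa [hu, hv, Real.sqrt_one, one_mul, one_mul] at this
    _ = (∑ y : Fin (Module.finrank ℝ W₁) × Fin (Module.finrank ℝ W₂),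
          1 * √(∑ t, g y.1 y.2 t ^ 2)) * b := by
        rw [Fintype.sum_prod_type]
        simp_rw [one_mul, ← Finset.mul_sum]
        rw [mul_comm]
    _ ≤ √(m * n) * √(∑ x, D x ^ 2) * b := by
        gcongr
        refine (Real.sum_mul_le_sqrt_mul_sqrt Finset.univ _ _).trans ?_
        rw [← pars]
        have : ∀ y : Fin (Module.finrank ℝ W₁) × Fin (Module.finrank ℝ W₂),
            √(∑ t, g y.1 y.2 t ^ 2) ^ 2 = ∑ t, g y.1 y.2 t ^ 2 :=
          fun y => Real.sq_sqrt (Finset.sum_nonneg fun _ _ => sq_nonneg _)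
        simp_rw [this, Fintype.sum_prod_type]
        gcongr
        simp only [one_pow, Finset.sum_const, Finset.card_univ, Fintype.card_fin, nsmul_eq_mul,
          mul_one]
        gcongr

/-! ### Nets and the mean spectral norm of a random sign tensor. -/

/-- A maximal 1-separated subset of the ball of radius 2 has at most 5ⁿ points and is a 1-net of
that ball; halving it gives a 1/2-net of the unit ball. A linear form loses at most half its norm on
such a net, hence the factor 2. -/
theorem exists_halfNet (n : ℕ) : ∃ 𝒩 : Finset (Fin n → ℝ), 𝒩.Nonempty ∧ 𝒩.card ≤ 5 ^ n ∧
    (∀ y ∈ 𝒩, ∑ i, y i ^ 2 ≤ 1) ∧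
    ∀ (a : Fin n → ℝ) (c : ℝ), (∀ y ∈ 𝒩, ∑ i, a i * y i ≤ c) →
      ∀ x : Fin n → ℝ, ∑ i, a i * x i ≤ 2 * c * √(∑ i, x i ^ 2) := by
  classical
  let E := EuclideanSpace ℝ (Fin n)
  let S : Set ℕ := {m | ∃ s : Finset E, s.card = m ∧ (∀ c ∈ s, ‖c‖ ≤ 2) ∧
    ∀ c ∈ s, ∀ d ∈ s, c ≠ d → 1 ≤ ‖c - d‖}
  have hbdd : BddAbove S := ⟨5 ^ n, by
    rintro m ⟨s, rfl, h1, h2⟩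
    simpa [E] using Besicovitch.card_le_of_separated s h1 h2⟩
  have hne : S.Nonempty := ⟨0, ∅, by simp⟩
  obtain ⟨s, hs, h1, h2⟩ := Nat.sSup_mem hne hbdd
  have hcard : s.card ≤ 5 ^ n := by simpa [E] using Besicovitch.card_le_of_separated s h1 h2
  have hnet : ∀ x : E, ‖x‖ ≤ 2 → ∃ y ∈ s, ‖x - y‖ ≤ 1 := by
    intro x hx
    by_contra! hcon
    have hxs : x ∉ s := fun h => by
      have := hcon x h
      simp at this
      linarith
    have : (insert x s).card ∈ S := by
      refine ⟨insert x s, rfl, ?_, ?_⟩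
      · intro c hc
        rcases Finset.mem_insert.1 hc with rfl | hc'
        exacts [hx, h1 c hc']
      · intro c hc d hd hcd
        rcases Finset.mem_insert.1 hc with hc' | hc' <;>
          rcases Finset.mem_insert.1 hd with hd' | hd'
        · exact absurd (hc'.trans hd'.symm) hcd
        · rw [hc']; exact (hcon d hd').le
        · rw [hd', norm_sub_rev]; exact (hcon c hc').le
        · exact h2 c hc' d hd' hcd
    have h3 := le_csSup hbdd this
    rw [Finset.card_insert_of_notMem hxs, ← hs] at h3
    omega
  have norm_sq : ∀ x : E, ‖x‖ ^ 2 = ∑ i, x i ^ 2 := fun x => by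
    rw [EuclideanSpace.norm_eq, Real.sq_sqrt (by positivity)]; simp
  have inner_eq : ∀ x y : E, inner ℝ x y = ∑ i, x i * y i := fun x y => by
    rw [PiLp.inner_apply]
    exact Finset.sum_congr rfl fun i _ => by simp [mul_comm]
  refine ⟨s.image fun y i => y i / 2, ?_, Finset.card_image_le.trans hcard, ?_, ?_⟩
  · obtain ⟨y, hy, -⟩ := hnet 0 (by simp)
    exact ⟨_, Finset.mem_image_of_mem _ hy⟩
  · intro y hy
    obtain ⟨z, hz, rfl⟩ := Finset.mem_image.1 hy
    have h3 := h1 z hz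
    have h4 := norm_sq z
    simp_rw [div_pow]
    rw [← Finset.sum_div, ← h4]
    nlinarith [norm_nonneg z]
  · intro a c hc x
    have hA : ‖WithLp.toLp 2 a‖ ≤ 2 * c := by
      set A : E := WithLp.toLp 2 a with hA
      -- The test point is the multiple of `A` of norm 2; if `A = 0`, division by zero makes it 0,
      -- which still lies in the ball.
      obtain ⟨y, hy, hxy⟩ := hnet ((2 / ‖A‖) • A) (by
        rw [norm_smul, Real.norm_of_nonneg (by positivity)]
        rcases eq_or_ne ‖A‖ 0 with h | h
        · rw [h]; norm_num
        · rw [div_mul_cancel₀ _ h])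
      have h3 := hc _ (Finset.mem_image_of_mem _ hy)
      have h4 : inner ℝ A y ≤ 2 * c := by
        rw [inner_eq]
        have : ∑ i, a i * (y i / 2) = (∑ i, A i * y i) / 2 := by
          rw [Finset.sum_div]
          exact Finset.sum_congr rfl fun i _ => by rw [hA]; simp; ring
        rw [this] at h3
        linarith
      have h5 : inner ℝ A ((2 / ‖A‖) • A) = 2 * ‖A‖ := by
        rw [inner_smul_right, real_inner_self_eq_norm_sq]
        rcases eq_or_ne ‖A‖ 0 with h | h
        · rw [h]; norm_num
        · field_simp
      have h6 : inner ℝ A ((2 / ‖A‖) • A - y) ≤ ‖A‖ :=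
        (real_inner_le_norm _ _).trans (mul_le_of_le_one_right (norm_nonneg _) hxy)
      rw [inner_sub_right, h5] at h6
      linarith
    have h7 := real_inner_le_norm (WithLp.toLp 2 a : E) (WithLp.toLp 2 x)
    rw [inner_eq] at h7
    have h8 : ‖(WithLp.toLp 2 x : E)‖ = √(∑ i, x i ^ 2) := by
      rw [← Real.sqrt_sq (norm_nonneg _), norm_sq]
    rw [h8] at h7
    exact h7.trans (by gcongr)

/-- The sign `±1` encoded by a Boolean. -/
noncomputable def signVal (b : Bool) : ℝ := if b then 1 else -1

/-- The mean of `f` over uniformly random signs. -/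
noncomputable def signMean {X : Type*} [Fintype X] [DecidableEq X] (f : (X → Bool) → ℝ) : ℝ :=
  ((2 : ℝ) ^ Fintype.card X)⁻¹ * ∑ s, f s

theorem signMean_mono {X : Type*} [Fintype X] [DecidableEq X] {f g : (X → Bool) → ℝ}
    (h : ∀ s, f s ≤ g s) : signMean f ≤ signMean g := by
  unfold signMean
  gcongr
  exact h _

theorem signMean_mul_left {X : Type*} [Fintype X] [DecidableEq X] (c : ℝ) (f : (X → Bool) → ℝ) :
    signMean (fun s => c * f s) = c * signMean f := by
  unfold signMean
  rw [← Finset.mul_sum]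
  ring

/-- The exponential factorizes over coordinates, and cosh y ≤ exp(y²/2) in each. -/
theorem sum_exp_sign_le {X : Type*} [Fintype X] [DecidableEq X] (w : X → ℝ) (l : ℝ)
    (hw : ∑ x, w x ^ 2 ≤ 1) :
    ∑ s : X → Bool, Real.exp (l * ∑ x, signVal (s x) * w x)
      ≤ 2 ^ Fintype.card X * Real.exp (l ^ 2 / 2) := by
  have h1 : ∀ s : X → Bool, Real.exp (l * ∑ x, signVal (s x) * w x)
      = ∏ x, Real.exp (l * (signVal (s x) * w x)) := by
    intro s
    rw [Finset.mul_sum, Real.exp_sum]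
  simp_rw [h1]
  have h2 := Finset.prod_univ_sum (fun _ : X => (Finset.univ : Finset Bool))
    fun x b => Real.exp (l * (signVal b * w x))
  rw [Fintype.piFinset_univ] at h2
  rw [← h2]
  calc _ ≤ ∏ x, (2 * Real.exp ((l * w x) ^ 2 / 2)) := by
        refine Finset.prod_le_prod (fun _ _ => Finset.sum_nonneg fun _ _ => (Real.exp_pos _).le)
          fun x _ => ?_
        have := Real.cosh_le_exp_half_sq (l * w x)
        rw [Real.cosh_eq] at this
        simp only [Fintype.sum_bool, signVal]
        simp only [if_true, one_mul, Bool.false_eq_true, if_false, neg_mul, mul_neg]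
        linarith
    _ = 2 ^ Fintype.card X * Real.exp (l ^ 2 / 2 * ∑ x, w x ^ 2) := by
        rw [Finset.prod_mul_distrib, Finset.prod_const, Finset.card_univ, ← Real.exp_sum,
          Finset.mul_sum]
        congr 2
        exact Finset.sum_congr rfl fun x _ => by ring
    _ ≤ _ := by
        gcongr
        exact mul_le_of_le_one_right (by positivity) hw

/-- The maximal inequality for finitely many Rademacher sums. -/
theorem signMean_le_of_finset {X : Type*} [Fintype X] [DecidableEq X] {𝒲 : Finset (X → ℝ)}
    (hw : ∀ w ∈ 𝒲, ∑ x, w x ^ 2 ≤ 1) {F : (X → Bool) → ℝ}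
    (hF : ∀ s, ∃ w ∈ 𝒲, F s ≤ ∑ x, signVal (s x) * w x) {l : ℝ} (hl : 0 < l) :
    signMean F ≤ Real.log 𝒲.card / l + l / 2 := by
  have hcard : (0 : ℝ) < 𝒲.card := by
    obtain ⟨w, hw, -⟩ := hF fun _ => true
    exact_mod_cast Finset.card_pos.2 ⟨w, hw⟩
  set a : ℝ := 𝒲.card * Real.exp (l ^ 2 / 2) with ha
  have ha0 : 0 < a := by positivity
  have hlog : Real.log a = Real.log 𝒲.card + l ^ 2 / 2 := by
    rw [ha, Real.log_mul hcard.ne' (Real.exp_pos _).ne', Real.log_exp]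
  have h1 : ∀ s, l * F s
      ≤ a⁻¹ * (∑ w ∈ 𝒲, Real.exp (l * ∑ x, signVal (s x) * w x)) + (Real.log a - 1) := by
    intro s
    obtain ⟨w, hw, h⟩ := hF s
    -- The tangent-line bound for the logarithm at `a` plays the role of Jensen's inequality; `a`
    -- bounds the mean of the sum of exponentials, so the averaged first term is at most 1.
    have h2 := Real.log_le_sub_one_of_pos (x := a⁻¹ * Real.exp (l * F s)) (by positivity)
    rw [Real.log_mul (by positivity) (Real.exp_pos _).ne', Real.log_exp, Real.log_inv] at h2
    have h3 : Real.exp (l * F s) ≤ ∑ w ∈ 𝒲, Real.exp (l * ∑ x, signVal (s x) * w x) :=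
      (Real.exp_le_exp.2 (by gcongr)).trans (Finset.single_le_sum
        (f := fun w => Real.exp (l * ∑ x, signVal (s x) * w x)) (fun _ _ => (Real.exp_pos _).le) hw)
    have h4 := mul_le_mul_of_nonneg_left h3 (inv_pos.2 ha0).le
    linarith
  have h2 : l * signMean F ≤ Real.log a := by
    rw [← signMean_mul_left]
    refine (signMean_mono h1).trans ?_
    unfold signMean
    rw [Finset.sum_add_distrib, ← Finset.mul_sum, Finset.sum_comm]
    have h5 : ∑ w ∈ 𝒲, ∑ s : X → Bool, Real.exp (l * ∑ x, signVal (s x) * w x)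
        ≤ 2 ^ Fintype.card X * a := by
      calc _ ≤ ∑ _w ∈ 𝒲, 2 ^ Fintype.card X * Real.exp (l ^ 2 / 2) :=
            Finset.sum_le_sum fun w h => sum_exp_sign_le w l (hw w h)
        _ = _ := by rw [Finset.sum_const, nsmul_eq_mul, ha]; ring
    have h6 : ∑ _s : X → Bool, (Real.log a - 1) = 2 ^ Fintype.card X * (Real.log a - 1) := by
      simp only [Finset.sum_const, Finset.card_univ, Fintype.card_fun, Fintype.card_bool,
        nsmul_eq_mul]
      push_cast
      rfl
    rw [h6]
    calc _ ≤ ((2 : ℝ) ^ Fintype.card X)⁻¹ * (a⁻¹ * (2 ^ Fintype.card X * a)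
          + 2 ^ Fintype.card X * (Real.log a - 1)) := by gcongr
      _ = Real.log a := by field_simp; ring
  rw [hlog] at h2
  have h3 : signMean F ≤ (Real.log 𝒲.card + l ^ 2 / 2) / l := by
    rw [le_div_iff₀ hl, mul_comm]; exact h2
  refine h3.trans (le_of_eq ?_)
  field_simp

/-- Flipping the sign of one test vector flips the left side and keeps the right. -/
theorem SpectralBound.nonneg {α β γ : Type*} [Fintype α] [Fintype β] [Fintype γ] [Nonempty α]
    [Nonempty β] [Nonempty γ] {s : α × β × γ → ℝ} {b : ℝ} (h : SpectralBound s b) : 0 ≤ b := by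
  have h1 := h (fun _ => 1) (fun _ => 1) fun _ => 1
  have h2 := h (fun _ => -1) (fun _ => 1) fun _ => 1
  simp only [one_pow, mul_neg, even_two, Even.neg_pow, mul_one, Finset.sum_neg_distrib]
    at h1 h2
  have h3 : 0 < √(∑ _i : α, (1 : ℝ)) * √(∑ _i : β, (1 : ℝ)) * √(∑ _i : γ, (1 : ℝ)) := by
    simp only [Finset.sum_const, Finset.card_univ, nsmul_eq_mul, mul_one]
    have h4 := Fintype.card_pos (α := α)
    have h5 := Fintype.card_pos (α := β)
    have h6 := Fintype.card_pos (α := γ)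
    positivity
  nlinarith

/-- Isolating one mode exhibits the trilinear form as a linear form in that argument, so that the
nets can be removed one mode at a time. -/
theorem sum_tensor_one {α β γ : Type*} [Fintype α] [Fintype β] [Fintype γ] (s : α × β × γ → ℝ)
    (u : α → ℝ) (v : β → ℝ) (w : γ → ℝ) : ∑ x, s x * (u x.1 * v x.2.1 * w x.2.2)
      = ∑ i, (∑ j, ∑ t, s (i, j, t) * (v j * w t)) * u i := by
  simp_rw [Fintype.sum_prod_type, Finset.sum_mul]
  exact Finset.sum_congr rfl fun i _ => Finset.sum_congr rfl fun j _ =>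
    Finset.sum_congr rfl fun t _ => by ring

theorem sum_tensor_two {α β γ : Type*} [Fintype α] [Fintype β] [Fintype γ] (s : α × β × γ → ℝ)
    (u : α → ℝ) (v : β → ℝ) (w : γ → ℝ) : ∑ x, s x * (u x.1 * v x.2.1 * w x.2.2)
      = ∑ j, (∑ i, ∑ t, s (i, j, t) * (u i * w t)) * v j := by
  simp_rw [Fintype.sum_prod_type, Finset.sum_mul]
  rw [Finset.sum_comm]
  exact Finset.sum_congr rfl fun j _ => Finset.sum_congr rfl fun i _ =>
    Finset.sum_congr rfl fun t _ => by ring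

theorem sum_tensor_three {α β γ : Type*} [Fintype α] [Fintype β] [Fintype γ] (s : α × β × γ → ℝ)
    (u : α → ℝ) (v : β → ℝ) (w : γ → ℝ) : ∑ x, s x * (u x.1 * v x.2.1 * w x.2.2)
      = ∑ t, (∑ i, ∑ j, s (i, j, t) * (u i * v j)) * w t := by
  simp_rw [Fintype.sum_prod_type, Finset.sum_mul]
  rw [Finset.sum_comm (s := (Finset.univ : Finset γ))]
  refine Finset.sum_congr rfl fun i _ => ?_
  rw [Finset.sum_comm]
  exact Finset.sum_congr rfl fun t _ => Finset.sum_congr rfl fun j _ => by ring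

theorem sum_tensor_sq {α β γ : Type*} [Fintype α] [Fintype β] [Fintype γ]
    (u : α → ℝ) (v : β → ℝ) (w : γ → ℝ) :
    ∑ x : α × β × γ, (u x.1 * v x.2.1 * w x.2.2) ^ 2
      = (∑ i, u i ^ 2) * (∑ j, v j ^ 2) * ∑ t, w t ^ 2 := by
  rw [Finset.sum_mul_sum, Finset.sum_mul]
  simp_rw [Fintype.sum_prod_type, Finset.sum_mul_sum, mul_pow]

/-- The mean spectral norm of a `p₁ × p₂ × T` tensor of random signs is `O(√(p₁ + p₂ + T))`. -/
theorem exists_spectralBound {p₁ p₂ T : ℕ} (hp : 0 < p₁ + p₂ + T) :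
    ∃ b : (Fin p₁ × Fin p₂ × Fin T → Bool) → ℝ,
      (∀ s, SpectralBound (fun x => signVal (s x)) (b s)) ∧
      signMean b ≤ 20 * √(p₁ + p₂ + T) := by
  classical
  obtain ⟨N₁, ne₁, card₁, le₁, net₁⟩ := exists_halfNet p₁
  obtain ⟨N₂, ne₂, card₂, le₂, net₂⟩ := exists_halfNet p₂
  obtain ⟨N₃, ne₃, card₃, le₃, net₃⟩ := exists_halfNet T
  let ten : (Fin p₁ → ℝ) × (Fin p₂ → ℝ) × (Fin T → ℝ) → Fin p₁ × Fin p₂ × Fin T → ℝ :=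
    fun y x => y.1 x.1 * y.2.1 x.2.1 * y.2.2 x.2.2
  have ne : (N₁ ×ˢ N₂ ×ˢ N₃).Nonempty := ne₁.product (ne₂.product ne₃)
  let 𝒲 := (N₁ ×ˢ N₂ ×ˢ N₃).image ten
  have ne𝒲 : 𝒲.Nonempty := ne.image _
  let F : (Fin p₁ × Fin p₂ × Fin T → Bool) → ℝ := fun s =>
    𝒲.sup' ne𝒲 fun w => ∑ x, signVal (s x) * w x
  have hF : ∀ s, ∀ u ∈ N₁, ∀ v ∈ N₂, ∀ w ∈ N₃,
      ∑ x : Fin p₁ × Fin p₂ × Fin T, signVal (s x) * (u x.1 * v x.2.1 * w x.2.2) ≤ F s :=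
    fun s u hu v hv w hw => Finset.le_sup' (fun w => ∑ x, signVal (s x) * w x)
      (Finset.mem_image_of_mem ten (Finset.mk_mem_product hu (Finset.mk_mem_product hv hw)))
  -- Each of the three nets costs a factor 2, whence 8 = 2³.
  refine ⟨fun s => 8 * F s, fun s u v w => ?_, ?_⟩
  · have h1 : ∀ v ∈ N₂, ∀ w ∈ N₃, ∀ u : Fin p₁ → ℝ,
        ∑ x : Fin p₁ × Fin p₂ × Fin T, signVal (s x) * (u x.1 * v x.2.1 * w x.2.2)
          ≤ 2 * F s * √(∑ i, u i ^ 2) := by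
      intro v hv w hw u
      rw [sum_tensor_one fun x => signVal (s x)]
      refine net₁ _ _ (fun u hu => ?_) u
      rw [← sum_tensor_one fun x => signVal (s x)]
      exact hF s u hu v hv w hw
    have h2 : ∀ w ∈ N₃, ∀ (u : Fin p₁ → ℝ) (v : Fin p₂ → ℝ),
        ∑ x : Fin p₁ × Fin p₂ × Fin T, signVal (s x) * (u x.1 * v x.2.1 * w x.2.2)
          ≤ 2 * (2 * F s * √(∑ i, u i ^ 2)) * √(∑ j, v j ^ 2) := by
      intro w hw u v
      rw [sum_tensor_two fun x => signVal (s x)]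
      refine net₂ _ _ (fun v hv => ?_) v
      rw [← sum_tensor_two fun x => signVal (s x)]
      exact h1 v hv w hw u
    have h3 : ∑ x : Fin p₁ × Fin p₂ × Fin T, signVal (s x) * (u x.1 * v x.2.1 * w x.2.2)
        ≤ 2 * (2 * (2 * F s * √(∑ i, u i ^ 2)) * √(∑ j, v j ^ 2)) * √(∑ t, w t ^ 2) := by
      rw [sum_tensor_three fun x => signVal (s x)]
      refine net₃ _ _ (fun w hw => ?_) w
      rw [← sum_tensor_three fun x => signVal (s x)]
      exact h2 w hw u v
    refine h3.trans (le_of_eq ?_)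
    ring
  · rw [signMean_mul_left]
    set n : ℕ := p₁ + p₂ + T with hn
    have hn0 : (0 : ℝ) < n := by exact_mod_cast hp
    have hcast : (p₁ : ℝ) + p₂ + T = n := by rw [hn]; push_cast; ring
    rw [hcast]
    have hcard : 𝒲.card ≤ 5 ^ n := by
      calc 𝒲.card ≤ N₁.card * (N₂.card * N₃.card) := by
            rw [← Finset.card_product, ← Finset.card_product]; exact Finset.card_image_le
        _ ≤ 5 ^ p₁ * (5 ^ p₂ * 5 ^ T) := by gcongr
        _ = 5 ^ n := by rw [hn]; ring
    -- With `l = √n` and log-cardinality at most 2n, the maximum has mean at most 2√n + √n/2;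
    -- multiplying by 8 gives 20√n.
    have key := signMean_le_of_finset (𝒲 := 𝒲) (F := F) (l := √n) (fun w hw => ?_)
      (fun s => ?_) (by positivity)
    · have h1 : Real.log 𝒲.card ≤ n * 2 := by
        have h2 : Real.log 𝒲.card ≤ Real.log ((5 : ℝ) ^ n) :=
          Real.log_le_log (by exact_mod_cast ne𝒲.card_pos) (by exact_mod_cast hcard)
        rw [Real.log_pow] at h2
        have h5 : Real.log 5 ≤ 2 := by
          rw [Real.log_le_iff_le_exp (by norm_num), show (2 : ℝ) = 1 + 1 by norm_num, Real.exp_add]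
          nlinarith [Real.exp_one_gt_d9]
        exact h2.trans (by gcongr)
      have h3 : Real.log 𝒲.card / √n ≤ 2 * √n := by
        rw [div_le_iff₀ (by positivity), mul_assoc, Real.mul_self_sqrt hn0.le]
        linarith
      linarith
    · obtain ⟨y, hy, rfl⟩ := Finset.mem_image.1 hw
      obtain ⟨h1, h2⟩ := Finset.mem_product.1 hy
      obtain ⟨h2, h3⟩ := Finset.mem_product.1 h2
      change ∑ x : Fin p₁ × Fin p₂ × Fin T, (y.1 x.1 * y.2.1 x.2.1 * y.2.2 x.2.2) ^ 2 ≤ 1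
      rw [sum_tensor_sq]
      have nn : ∀ {m : ℕ} (z : Fin m → ℝ), 0 ≤ ∑ i, z i ^ 2 :=
        fun z => Finset.sum_nonneg fun _ _ => sq_nonneg _
      exact mul_le_one₀ (mul_le_one₀ (le₁ _ h1) (nn _) (le₂ _ h2)) (nn _) (le₃ _ h3)
    · obtain ⟨w, hw, h⟩ := Finset.exists_mem_eq_sup' ne𝒲 fun w => ∑ x, signVal (s x) * w x
      exact ⟨w, hw, h.le⟩

/-! ### The check loss and its increments. -/

theorem checkLoss_eq (τ u : ℝ) : checkLoss τ u = τ * u + max 0 (-u) := by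
  unfold checkLoss
  split_ifs with h
  · rw [max_eq_right (by linarith)]; ring
  · rw [max_eq_left (by linarith)]; ring

/-- The increment `ρ_τ(u - δ) - ρ_τ(u)` of the check loss. -/
noncomputable def excess (τ u δ : ℝ) : ℝ := checkLoss τ (u - δ) - checkLoss τ u

theorem excess_eq (τ u δ : ℝ) : excess τ u δ = max 0 (δ - u) - max 0 (-u) - τ * δ := by
  rw [excess, checkLoss_eq, checkLoss_eq, neg_sub]
  ring

theorem excess_zero (τ u : ℝ) : excess τ u 0 = 0 := by simp [excess_eq]

theorem continuous_excess (τ δ : ℝ) : Continuous fun u => excess τ u δ := by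
  simp_rw [excess_eq]
  fun_prop

theorem abs_excess_sub_le {τ : ℝ} (hτ : 0 ≤ τ) (hτ' : τ ≤ 1) (u δ δ' : ℝ) :
    |excess τ u δ - excess τ u δ'| ≤ |δ - δ'| := by
  wlog h : δ' ≤ δ generalizing δ δ'
  · rw [abs_sub_comm, abs_sub_comm δ]
    exact this _ _ (le_of_not_ge h)
  rw [excess_eq, excess_eq, abs_of_nonneg (sub_nonneg.2 h), abs_le]
  constructor <;> rcases max_cases 0 (δ - u) with ⟨h1, h2⟩ | ⟨h1, h2⟩ <;>
    rcases max_cases 0 (δ' - u) with ⟨h3, h4⟩ | ⟨h3, h4⟩ <;> rw [h1, h3] <;> nlinarith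

theorem abs_excess_le {τ : ℝ} (hτ : 0 ≤ τ) (hτ' : τ ≤ 1) (u δ : ℝ) : |excess τ u δ| ≤ |δ| := by
  simpa [excess_zero] using abs_excess_sub_le hτ hτ' u δ 0

/-- For δ' ≤ δ, the increment from δ' to δ is −τ(δ − δ') plus a term in [0, δ − δ'], and the τ part
cancels between `u` and `u'`. Applying the Lipschitz bound twice would lose a factor 2. -/
theorem excess_cross_le (τ u u' δ δ' : ℝ) :
    (excess τ u δ - excess τ u' δ) - (excess τ u δ' - excess τ u' δ') ≤ |δ - δ'| := by
  wlog h : δ' ≤ δ generalizing δ δ' u u'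
  · have := this u' u δ' δ (le_of_not_ge h)
    rw [abs_sub_comm]
    linarith
  simp_rw [excess_eq]
  rw [abs_of_nonneg (sub_nonneg.2 h)]
  rcases max_cases 0 (δ - u) with ⟨h1, h2⟩ | ⟨h1, h2⟩ <;>
    rcases max_cases 0 (δ' - u) with ⟨h3, h4⟩ | ⟨h3, h4⟩ <;>
    rcases max_cases 0 (δ - u') with ⟨h5, h6⟩ | ⟨h5, h6⟩ <;>
    rcases max_cases 0 (δ' - u') with ⟨h7, h8⟩ | ⟨h7, h8⟩ <;> linarith

/-- Convexity in δ, together with the value 0 at δ = 0. -/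
theorem excess_mul_le {τ : ℝ} {t : ℝ} (ht : 0 ≤ t) (ht' : t ≤ 1) (u δ : ℝ) :
    excess τ u (t * δ) ≤ t * excess τ u δ := by
  simp_rw [excess_eq]
  have h1 : max 0 (t * δ - u) ≤ t * max 0 (δ - u) + (1 - t) * max 0 (-u) := by
    have h2 := le_max_left 0 (δ - u)
    have h3 := le_max_right 0 (δ - u)
    have h4 := le_max_left 0 (-u)
    have h5 := le_max_right 0 (-u)
    apply max_le
    · nlinarith
    · nlinarith
  linarith

/-! ### Symmetrization and contraction. -/

/-- The index set may be uncountable; a bounded supremum of continuous functions is still lower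
semicontinuous, hence measurable. -/
theorem integrable_iSup {ι X : Type*} [Nonempty ι] [TopologicalSpace X] [MeasurableSpace X]
    [OpensMeasurableSpace X] (ν : Measure X) [IsFiniteMeasure ν] {f : ι → X → ℝ} {c : ℝ}
    (hf : ∀ i, Continuous (f i)) (hc : ∀ i x, |f i x| ≤ c) :
    Integrable (fun x => ⨆ i, f i x) ν := by
  have hbdd : ∀ x, BddAbove (Set.range fun i => f i x) := fun x =>
    ⟨c, by rintro _ ⟨i, rfl⟩; exact (abs_le.1 (hc i x)).2⟩
  have hm : Measurable fun x => ⨆ i, f i x :=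
    (lowerSemicontinuous_ciSup hbdd fun i => (hf i).lowerSemicontinuous).measurable
  refine Integrable.of_bound hm.aestronglyMeasurable c (Eventually.of_forall fun x => ?_)
  rw [Real.norm_eq_abs, abs_le]
  obtain ⟨i⟩ := ‹Nonempty ι›
  exact ⟨(abs_le.1 (hc i x)).1.trans (le_ciSup (hbdd x) i), ciSup_le fun i => (abs_le.1 (hc i x)).2⟩

theorem integrable_excess (μ : Measure ℝ) [IsFiniteMeasure μ] {τ : ℝ} (hτ : 0 ≤ τ) (hτ' : τ ≤ 1)
    (δ : ℝ) : Integrable (fun u => excess τ u δ) μ :=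
  Integrable.of_bound (continuous_excess τ δ).aestronglyMeasurable |δ|
    (Eventually.of_forall fun u => abs_excess_le hτ hτ' u δ)

theorem abs_integral_excess_le (μ : Measure ℝ) [IsProbabilityMeasure μ] {τ : ℝ} (hτ : 0 ≤ τ)
    (hτ' : τ ≤ 1) (δ : ℝ) : |∫ u, excess τ u δ ∂μ| ≤ |δ| := by
  have := norm_integral_le_of_norm_le_const (μ := μ) (f := fun u => excess τ u δ) (C := |δ|)
    (Eventually.of_forall fun u => abs_excess_le hτ hτ' u δ)
  simpa using this

/-- Symmetrization and contraction in a single coordinate. -/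
theorem integral_iSup_excess_le {ι : Type*} [Nonempty ι] (μ : Measure ℝ) [IsProbabilityMeasure μ]
    {τ : ℝ} (hτ : 0 ≤ τ) (hτ' : τ ≤ 1) {A δ : ι → ℝ} {a B : ℝ} (hA : ∀ i, |A i| ≤ a)
    (hδ : ∀ i, |δ i| ≤ B) :
    ∫ u, ⨆ i, (A i + (∫ v, excess τ v (δ i) ∂μ - excess τ u (δ i))) ∂μ
      ≤ 2⁻¹ * ((⨆ i, (A i + δ i)) + ⨆ i, (A i - δ i)) := by
  set J := (⨆ i, (A i + δ i)) + ⨆ i, (A i - δ i) with hJ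
  let f : ι → ℝ × ℝ → ℝ := fun i y => A i + (excess τ y.2 (δ i) - excess τ y.1 (δ i))
  have he : ∀ i u, |excess τ u (δ i)| ≤ B := fun i u => (abs_excess_le hτ hτ' u _).trans (hδ i)
  have hm : ∀ i, |∫ v, excess τ v (δ i) ∂μ| ≤ B := fun i =>
    (abs_integral_excess_le μ hτ hτ' _).trans (hδ i)
  have fcont : ∀ i, Continuous (f i) := fun i =>
    continuous_const.add (((continuous_excess τ _).comp continuous_snd).sub
      ((continuous_excess τ _).comp continuous_fst))
  have fbd : ∀ i y, |f i y| ≤ a + (B + B) := fun i y =>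
    (abs_add_le _ _).trans (add_le_add (hA i) ((abs_sub _ _).trans (add_le_add (he _ _) (he _ _))))
  have bdd : ∀ y, BddAbove (Set.range fun i => f i y) := fun y =>
    ⟨_, by rintro _ ⟨i, rfl⟩; exact (abs_le.1 (fbd i y)).2⟩
  have int := integrable_iSup (μ.prod μ) fcont fbd
  have intsec : ∀ u, Integrable (fun v => ⨆ i, f i (u, v)) μ := fun u =>
    integrable_iSup μ (fun i => (fcont i).comp (by fun_prop)) fun i v => fbd i (u, v)
  -- The mean is an integral over an independent copy `v`, and a supremum of integrals is at most
  -- the integral of the supremum.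
  have step : ∀ u, ⨆ i, (A i + (∫ v, excess τ v (δ i) ∂μ - excess τ u (δ i)))
      ≤ ∫ v, ⨆ i, f i (u, v) ∂μ := by
    intro u
    refine ciSup_le fun i => ?_
    have : A i + (∫ v, excess τ v (δ i) ∂μ - excess τ u (δ i)) = ∫ v, f i (u, v) ∂μ := by
      have h1 := integrable_excess μ hτ hτ' (δ i)
      have h2 : Integrable (fun v => excess τ v (δ i) - excess τ u (δ i)) μ :=
        h1.sub (integrable_const _)
      simp only [f]
      rw [integral_add (integrable_const _) h2, integral_sub h1 (integrable_const _)]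
      simp
    rw [this]
    refine integral_mono (Integrable.of_bound ((fcont i).comp
      (by fun_prop)).aestronglyMeasurable _ (Eventually.of_forall fun v => fbd i (u, v)))
      (intsec u) fun v => le_ciSup (bdd (u, v)) i
  -- Exchanging the copies negates the difference of excesses. For a pair of indices the two
  -- differences combine to at most |δ i − δ j| by `excess_cross_le`, and the sign of δ i − δ j
  -- decides which index receives +δ and which −δ.
  have pt : ∀ y : ℝ × ℝ, (⨆ i, f i y) + ⨆ i, f i y.swap ≤ J := by
    intro y
    have b1 : BddAbove (Set.range fun i => A i + δ i) := ⟨a + B, by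
      rintro _ ⟨i, rfl⟩
      exact add_le_add (abs_le.1 (hA i)).2 (abs_le.1 (hδ i)).2⟩
    have b2 : BddAbove (Set.range fun i => A i - δ i) := ⟨a + B, by
      rintro _ ⟨i, rfl⟩
      have h1 := (abs_le.1 (hA i)).2
      have h2 := (abs_le.1 (hδ i)).1
      change A i - δ i ≤ a + B
      linarith⟩
    have h1 : ∀ i j, f i y + f j y.swap ≤ J := by
      intro i j
      have h2 := excess_cross_le τ y.2 y.1 (δ i) (δ j)
      simp only [f, Prod.fst_swap, Prod.snd_swap]
      have i1 := le_ciSup b1 i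
      have j1 := le_ciSup b1 j
      have i2 := le_ciSup b2 i
      have j2 := le_ciSup b2 j
      rcases abs_cases (δ i - δ j) with ⟨h3, -⟩ | ⟨h3, -⟩ <;> rw [h3] at h2 <;> linarith
    have h3 : ∀ j, ⨆ i, f i y ≤ J - f j y.swap := fun j =>
      ciSup_le fun i => by linarith [h1 i j]
    have h4 : ⨆ i, f i y.swap ≤ J - ⨆ i, f i y := ciSup_le fun j => by linarith [h3 j]
    linarith
  calc _ ≤ ∫ u, ∫ v, ⨆ i, f i (u, v) ∂μ ∂μ := by
        refine integral_mono (integrable_iSup μ (c := a + (B + B)) (fun i => ?_) fun i u => ?_)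
          int.integral_prod_left step
        · exact continuous_const.add (continuous_const.sub (continuous_excess τ _))
        · exact (abs_add_le _ _).trans (add_le_add (hA i)
            ((abs_sub _ _).trans (add_le_add (hm i) (he _ _))))
    _ = ∫ y, ⨆ i, f i y ∂μ.prod μ := (integral_prod _ int).symm
    _ = 2⁻¹ * ∫ y, ((⨆ i, f i y) + ⨆ i, f i y.swap) ∂μ.prod μ := by
        have h1 : Integrable (fun y : ℝ × ℝ => ⨆ i, f i y.swap) (μ.prod μ) := int.swap
        have h2 := integral_prod_swap (μ := μ) (ν := μ) fun y => ⨆ i, f i y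
        rw [integral_add int h1, h2]
        ring
    _ ≤ 2⁻¹ * J := by
        gcongr
        calc _ ≤ ∫ _y, J ∂μ.prod μ := integral_mono (int.add int.swap) (integrable_const _) pt
          _ = J := by simp

theorem signMean_cons {n : ℕ} (f : (Fin (n + 1) → Bool) → ℝ) :
    signMean f = signMean fun s : Fin n → Bool =>
      2⁻¹ * (f (Fin.cons true s) + f (Fin.cons false s)) := by
  unfold signMean
  rw [← (Fin.consEquiv fun _ => Bool).sum_comp f, Fintype.sum_prod_type, Fintype.sum_bool,
    ← Finset.mul_sum, Finset.sum_add_distrib]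
  simp only [Fintype.card_fin, pow_succ, mul_inv]
  change _ * (∑ y, f (Fin.cons true y) + ∑ y, f (Fin.cons false y)) = _
  ring

/-- Induction on the number of coordinates. The free term `A` makes this possible: with the first
error fixed, its contribution is absorbed into `A`, the remaining coordinates become signs, and then
`integral_iSup_excess_le` treats the first coordinate for each sign pattern. -/
theorem integral_iSup_sum_excess_le_fin {ι : Type*} [Nonempty ι] {τ : ℝ} (hτ : 0 ≤ τ)
    (hτ' : τ ≤ 1) {B : ℝ} : ∀ (n : ℕ) (μ : Fin n → Measure ℝ) [∀ x, IsProbabilityMeasure (μ x)]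
    {a : ℝ} (A : ι → ℝ) (D : ι → Fin n → ℝ), (∀ i, |A i| ≤ a) → (∀ i x, |D i x| ≤ B) →
    ∫ e, ⨆ i, (A i + ∑ x, (∫ v, excess τ v (D i x) ∂(μ x) - excess τ (e x) (D i x)))
        ∂(Measure.pi μ)
      ≤ signMean fun s => ⨆ i, (A i + ∑ x, signVal (s x) * D i x) := by
  intro n
  induction n with
  | zero =>
    intro μ _ a A D hA hD
    simp [signMean]
  | succ n ih =>
    intro μ _ a A D hA hD
    have he : ∀ i x u, |excess τ u (D i x)| ≤ B :=
      fun i x u => (abs_excess_le hτ hτ' u _).trans (hD i x)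
    have hm : ∀ i x, |∫ v, excess τ v (D i x) ∂(μ x)| ≤ B := fun i x =>
      (abs_integral_excess_le _ hτ hτ' _).trans (hD i x)
    have hd : ∀ i x u, |∫ v, excess τ v (D i x) ∂(μ x) - excess τ u (D i x)| ≤ B + B :=
      fun i x u => (abs_sub _ _).trans (add_le_add (hm i x) (he i x u))
    let A' : ℝ → ι → ℝ := fun u i => A i + (∫ v, excess τ v (D i 0) ∂(μ 0) - excess τ u (D i 0))
    have hA' : ∀ u i, |A' u i| ≤ a + (B + B) := fun u i =>
      (abs_add_le _ _).trans (add_le_add (hA i) (hd i 0 u))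
    let g : ι → ℝ × (Fin n → ℝ) → ℝ := fun i y => A' y.1 i +
      ∑ x : Fin n, (∫ v, excess τ v (D i x.succ) ∂(μ x.succ) - excess τ (y.2 x) (D i x.succ))
    have gcont : ∀ i, Continuous (g i) := by
      intro i
      refine Continuous.add (continuous_const.add (continuous_const.sub
        ((continuous_excess τ _).comp continuous_fst))) (continuous_finsetSum _ fun x _ =>
          continuous_const.sub ((continuous_excess τ _).comp (by fun_prop)))
    have gbd : ∀ i y, |g i y| ≤ a + (B + B) + ∑ _x : Fin n, (B + B) := fun i y =>
      (abs_add_le _ _).trans (add_le_add (hA' _ _) ((Finset.abs_sum_le_sum_abs _ _).trans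
        (Finset.sum_le_sum fun x _ => hd i x.succ _)))
    have int := integrable_iSup ((μ 0).prod (Measure.pi fun x : Fin n => μ x.succ)) gcont gbd
    have e1 : ∫ e, ⨆ i, (A i + ∑ x, (∫ v, excess τ v (D i x) ∂(μ x) - excess τ (e x) (D i x)))
        ∂(Measure.pi μ)
        = ∫ y, ⨆ i, g i y ∂((μ 0).prod (Measure.pi fun x : Fin n => μ x.succ)) := by
      have mp := measurePreserving_piFinSuccAbove (fun x => μ x) 0
      simp only [Fin.succAbove_zero] at mp
      rw [← mp.integral_comp' (fun y => ⨆ i, g i y)]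
      refine integral_congr_ae (Eventually.of_forall fun e => ?_)
      refine iSup_congr fun i => ?_
      simp only [g, A', Fin.sum_univ_succ]
      rw [add_assoc]
      rfl
    have intS : ∀ s : Fin n → Bool, Integrable (fun u =>
        ⨆ i, (A' u i + ∑ x : Fin n, signVal (s x) * D i x.succ)) (μ 0) := by
      intro s
      refine integrable_iSup (μ 0) (c := a + (B + B) + ∑ _x : Fin n, B) (fun i => ?_)
        fun i u => ?_
      · exact (continuous_const.add (continuous_const.sub (continuous_excess τ _))).add
          continuous_const
      · refine (abs_add_le _ _).trans (add_le_add (hA' _ _) ((Finset.abs_sum_le_sum_abs _ _).trans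
          (Finset.sum_le_sum fun x _ => ?_)))
        rw [abs_mul]
        have : |signVal (s x)| = 1 := by unfold signVal; split_ifs <;> simp
        rw [this, one_mul]
        exact hD _ _
    have hS : ∀ (s : Fin n → Bool) i, |A i + ∑ x : Fin n, signVal (s x) * D i x.succ|
        ≤ a + ∑ _x : Fin n, B := by
      intro s i
      refine (abs_add_le _ _).trans (add_le_add (hA _) ((Finset.abs_sum_le_sum_abs _ _).trans
          (Finset.sum_le_sum fun x _ => ?_)))
      rw [abs_mul]
      have : |signVal (s x)| = 1 := by unfold signVal; split_ifs <;> simp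
      rw [this, one_mul]
      exact hD _ _
    rw [e1, integral_prod _ int]
    calc _ ≤ ∫ u, signMean (fun s : Fin n → Bool =>
            ⨆ i, (A' u i + ∑ x : Fin n, signVal (s x) * D i x.succ)) ∂(μ 0) := by
          refine integral_mono int.integral_prod_left ?_ fun u => ?_
          · exact (integrable_finsetSum _ fun s _ => intS s).const_mul _
          · exact ih (fun x => μ x.succ) (A' u) (fun i x => D i x.succ) (hA' u) fun i x => hD _ _
      _ = signMean (fun s : Fin n → Bool => ∫ u,
            ⨆ i, (A' u i + ∑ x : Fin n, signVal (s x) * D i x.succ) ∂(μ 0)) := by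
          unfold signMean
          rw [integral_const_mul, integral_finsetSum _ fun s _ => intS s]
      _ ≤ signMean (fun s : Fin n → Bool => 2⁻¹ *
            ((⨆ i, (A i + ∑ x : Fin n, signVal (s x) * D i x.succ + D i 0)) +
              ⨆ i, (A i + ∑ x : Fin n, signVal (s x) * D i x.succ - D i 0))) := by
          refine signMean_mono fun s => ?_
          refine le_trans (le_of_eq ?_) (integral_iSup_excess_le (μ 0) hτ hτ' (hS s)
            fun i => hD i 0)
          refine integral_congr_ae (Eventually.of_forall fun u => iSup_congr fun i => ?_)
          simp only [A']
          ring
      _ = _ := by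
          rw [signMean_cons]
          congr 1
          funext s
          simp only [Fin.sum_univ_succ, Fin.cons_zero, Fin.cons_succ, signVal, if_true,
            Bool.false_eq_true, if_false]
          congr 3 <;> funext i <;> ring

/-- Symmetrization and contraction for the check loss: the expected supremum of the centred
empirical process is at most the mean of the supremum of the Rademacher sums. -/
theorem integral_iSup_sum_excess_le {ι X : Type*} [Nonempty ι] [Fintype X] [DecidableEq X] {τ : ℝ}
    (hτ : 0 ≤ τ) (hτ' : τ ≤ 1) {B : ℝ} (μ : X → Measure ℝ) [∀ x, IsProbabilityMeasure (μ x)]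
    (D : ι → X → ℝ) (hD : ∀ i x, |D i x| ≤ B) :
    ∫ e, ⨆ i, (∑ x, (∫ v, excess τ v (D i x) ∂(μ x) - excess τ (e x) (D i x))) ∂(Measure.pi μ)
      ≤ signMean fun s => ⨆ i, ∑ x, signVal (s x) * D i x := by
  let ε := (Fintype.equivFin X).symm
  have key := integral_iSup_sum_excess_le_fin hτ hτ' _ (fun k => μ (ε k)) (a := 0)
    (fun _ => 0) (fun i k => D i (ε k)) (by simp) fun i k => hD _ _
  simp only [zero_add] at key
  have mp := measurePreserving_piCongrLeft (fun x => μ x) ε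
  rw [← mp.integral_comp']
  convert key using 1
  · refine integral_congr_ae (Eventually.of_forall fun e => iSup_congr fun i => ?_)
    rw [← ε.sum_comp]
    refine Finset.sum_congr rfl fun k _ => ?_
    rw [MeasurableEquiv.coe_piCongrLeft, Equiv.piCongrLeft_apply_apply]
  · unfold signMean
    rw [Fintype.card_fin, ← (Equiv.arrowCongr ε (Equiv.refl Bool)).sum_comp]
    congr 1
    refine Finset.sum_congr rfl fun s _ => iSup_congr fun i => ?_
    rw [← ε.sum_comp]
    simp [Equiv.arrowCongr]

/-! ### Curvature of the expected loss and the exceptional event. -/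

/-- Quadratic lower bound for the expected increment of the check loss at a `τ`-quantile. -/
theorem le_integral_excess {μ : Measure ℝ} [IsProbabilityMeasure μ] {τ : ℝ} (hτ : 0 ≤ τ)
    (hτ' : τ ≤ 1) {c B : ℝ} (hq : μ (Set.Iic 0) = ENNReal.ofReal τ)
    (hd : ∀ a b, -B ≤ a → a ≤ b → b ≤ B → ENNReal.ofReal (c * (b - a)) ≤ μ (Set.Ioc a b))
    {δ : ℝ} (hδ : |δ| ≤ B) : c / 4 * δ ^ 2 ≤ ∫ u, excess τ u δ ∂μ := by
  -- The indicator of `Iic 0` minus τ has mean zero. The remaining gain is at least |δ|/2 on an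
  -- interval `S` of length |δ|/2 between 0 and δ/2, whose mass is at least c|δ|/2; the product is
  -- cδ²/4.
  have key : ∀ S : Set ℝ, MeasurableSet S → c * (|δ| / 2) ≤ μ.real S →
      (∀ u, δ * ((Set.Iic (0 : ℝ)).indicator 1 u - τ) + |δ| / 2 * S.indicator 1 u
        ≤ excess τ u δ) → c / 4 * δ ^ 2 ≤ ∫ u, excess τ u δ ∂μ := by
    intro S hS hmass hpt
    have i1 : Integrable ((Set.Iic (0 : ℝ)).indicator (1 : ℝ → ℝ)) μ :=
      (integrable_const (1 : ℝ)).indicator measurableSet_Iic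
    have i2 : Integrable (S.indicator (1 : ℝ → ℝ)) μ := (integrable_const (1 : ℝ)).indicator hS
    have i3 : Integrable (fun u => δ * ((Set.Iic (0 : ℝ)).indicator (1 : ℝ → ℝ) u - τ)) μ :=
      (i1.sub (integrable_const τ)).const_mul δ
    have i4 : Integrable (fun u => |δ| / 2 * S.indicator (1 : ℝ → ℝ) u) μ := i2.const_mul _
    have h1 := integral_mono (i3.add i4) (integrable_excess μ hτ hτ' δ) hpt
    have h2 : μ.real (Set.Iic 0) = τ := by
      rw [measureReal_def, hq, ENNReal.toReal_ofReal hτ]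
    simp only [Pi.add_apply] at h1
    rw [integral_add i3 i4, integral_const_mul, integral_const_mul,
      integral_sub i1 (integrable_const τ), integral_indicator_one measurableSet_Iic,
      integral_indicator_one hS, h2] at h1
    simp only [integral_const, probReal_univ, one_smul, sub_self, mul_zero, zero_add] at h1
    refine le_trans ?_ h1
    calc c / 4 * δ ^ 2 = |δ| / 2 * (c * (|δ| / 2)) := by rw [← sq_abs]; ring
      _ ≤ _ := by gcongr
  have mass : ∀ a b, -B ≤ a → a ≤ b → b ≤ B → c * (b - a) ≤ μ.real (Set.Ioc a b) := by
    intro a b ha hab hb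
    rw [measureReal_def, ← ENNReal.ofReal_le_iff_le_toReal (measure_ne_top _ _)]
    exact hd a b ha hab hb
  have hB := abs_le.1 hδ
  rcases le_or_gt 0 δ with h0 | h0
  · refine key (Set.Ioc 0 (δ / 2)) measurableSet_Ioc ?_ fun u => ?_
    · have := mass 0 (δ / 2) (by linarith) (by linarith) (by linarith)
      rw [sub_zero] at this
      rwa [abs_of_nonneg h0]
    · rw [excess_eq, abs_of_nonneg h0]
      simp only [Set.indicator, Set.mem_Iic, Set.mem_Ioc, Pi.one_apply]
      have h1 := le_max_left 0 (δ - u)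
      have h2 := le_max_right 0 (δ - u)
      split_ifs with h3 h4 h4
      · linarith [h4.1]
      · rw [max_eq_right (a := 0) (b := -u) (by linarith)]; nlinarith
      · rw [max_eq_left (a := 0) (b := -u) (by linarith)]; nlinarith [h4.2]
      · rw [max_eq_left (a := 0) (b := -u) (by linarith)]; nlinarith
  · refine key (Set.Ioc (δ / 2) 0) measurableSet_Ioc ?_ fun u => ?_
    · have := mass (δ / 2) 0 (by linarith) (by linarith) (by linarith)
      rw [abs_of_neg h0]
      convert this using 2
      ring
    · rw [excess_eq, abs_of_neg h0]
      simp only [Set.indicator, Set.mem_Iic, Set.mem_Ioc, Pi.one_apply]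
      have h1 := le_max_left 0 (δ - u)
      split_ifs with h3 h4 h4
      · rw [max_eq_right (a := 0) (b := -u) (by linarith)]; nlinarith [h4.1]
      · rw [max_eq_right (a := 0) (b := -u) (by linarith)]; nlinarith [le_max_right 0 (δ - u)]
      · linarith [h4.2]
      · rw [max_eq_left (a := 0) (b := -u) (by linarith)]; nlinarith

/-- Uniform control of the check loss over a class of perturbations of norm `r`: a single
measurable event contains all error realizations for which some perturbation does not increase the
loss, and its probability is bounded through the Rademacher complexity of the class. -/
theorem exists_measurable_superset {X : Type*} [Fintype X] [DecidableEq X] {τ : ℝ} (hτ : 0 ≤ τ)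
    (hτ' : τ ≤ 1) (𝒟 : Set (X → ℝ)) {B r : ℝ} (hr : 0 < r) (hB : ∀ D ∈ 𝒟, ∀ x, |D x| ≤ B)
    (hnorm : ∀ D ∈ 𝒟, ∑ x, D x ^ 2 = r ^ 2) {b : (X → Bool) → ℝ} (hb0 : ∀ s, 0 ≤ b s)
    (hb : ∀ D ∈ 𝒟, ∀ s, ∑ x, signVal (s x) * D x ≤ b s) :
    ∃ E : Set (X → ℝ), MeasurableSet E ∧
      (∀ e, (∃ D ∈ 𝒟, ∑ x, excess τ (e x) (D x) ≤ 0) → e ∈ E) ∧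
      ∀ (μ : X → Measure ℝ) [∀ x, IsProbabilityMeasure (μ x)] (c : ℝ), 0 < c →
        (∀ x, μ x (Set.Iic 0) = ENNReal.ofReal τ) →
        (∀ x a b, -B ≤ a → a ≤ b → b ≤ B →
          ENNReal.ofReal (c * (b - a)) ≤ μ x (Set.Ioc a b)) →
        Measure.pi μ E ≤ ENNReal.ofReal (4 * signMean b / (c * r ^ 2)) := by
  rcases 𝒟.eq_empty_or_nonempty with rfl | hne
  · exact ⟨∅, MeasurableSet.empty, by simp, by simp⟩
  obtain ⟨D₀, hD₀⟩ := hne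
  have hB0 : ∀ x : X, 0 ≤ B := fun x => (abs_nonneg _).trans (hB D₀ hD₀ x)
  have hne' : Nonempty 𝒟 := ⟨⟨D₀, hD₀⟩⟩
  let f₀ : 𝒟 → (X → ℝ) → ℝ := fun D e => -∑ x, excess τ (e x) (D.1 x)
  have f₀cont : ∀ D, Continuous (f₀ D) := fun D =>
    (continuous_finsetSum _ fun x _ => (continuous_excess τ _).comp (continuous_apply x)).neg
  have f₀bdd : ∀ e, BddAbove (Set.range fun D => f₀ D e) := fun e =>
    ⟨∑ _x : X, B, by
      rintro _ ⟨D, rfl⟩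
      refine (neg_le_abs _).trans ((Finset.abs_sum_le_sum_abs _ _).trans
        (Finset.sum_le_sum fun x _ => ?_))
      exact (abs_excess_le hτ hτ' _ _).trans (hB _ D.2 x)⟩
  have hmeas : Measurable fun e => ⨆ D, f₀ D e :=
    (lowerSemicontinuous_ciSup f₀bdd fun D => (f₀cont D).lowerSemicontinuous).measurable
  -- This event involves the uncentred losses only, so it does not depend on `μ`; one event
  -- therefore serves all conditional laws of the errors.
  refine ⟨{e | 0 ≤ ⨆ D, f₀ D e}, measurableSet_le measurable_const hmeas, ?_, ?_⟩
  · rintro e ⟨D, hD, h⟩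
    exact le_trans (neg_nonneg.2 h) (le_ciSup (f₀bdd e) ⟨D, hD⟩)
  intro μ _ c hc hq hd
  -- Adjoining the zero perturbation makes the supremum nonnegative, as Markov's inequality
  -- requires.
  let ι := ↥(insert (0 : X → ℝ) 𝒟)
  have hBι : ∀ (D : ι) x, |D.1 x| ≤ B := by
    rintro ⟨D, rfl | hD⟩ x
    · simpa using hB0 x
    · exact hB D hD x
  have key := integral_iSup_sum_excess_le hτ hτ' μ (fun (D : ι) => D.1) hBι
  let f : ι → (X → ℝ) → ℝ := fun D e =>
    ∑ x, (∫ v, excess τ v (D.1 x) ∂(μ x) - excess τ (e x) (D.1 x))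
  have fcont : ∀ D, Continuous (f D) := fun D =>
    continuous_finsetSum _ fun x _ =>
      continuous_const.sub ((continuous_excess τ _).comp (continuous_apply x))
  have fbd : ∀ D e, |f D e| ≤ ∑ _x : X, (B + B) := fun D e =>
    (Finset.abs_sum_le_sum_abs _ _).trans (Finset.sum_le_sum fun x _ =>
      (abs_sub _ _).trans (add_le_add
        ((abs_integral_excess_le _ hτ hτ' _).trans (hBι D x))
        ((abs_excess_le hτ hτ' _ _).trans (hBι D x))))
  have bdd : ∀ e, BddAbove (Set.range fun D => f D e) := fun e =>
    ⟨_, by rintro _ ⟨i, rfl⟩; exact (abs_le.1 (fbd i e)).2⟩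
  have hint := integrable_iSup (Measure.pi μ) fcont fbd
  have hnn : ∀ e, 0 ≤ ⨆ D, f D e := by
    intro e
    refine le_trans (le_of_eq ?_) (le_ciSup (bdd e) ⟨0, Set.mem_insert _ _⟩)
    simp [f, excess_zero]
  have hbound : signMean (fun s => ⨆ D : ι, ∑ x, signVal (s x) * D.1 x) ≤ signMean b := by
    refine signMean_mono fun s => ciSup_le ?_
    rintro ⟨D, rfl | hD⟩
    · simpa using hb0 s
    · exact hb D hD s
  have hsub : {e | 0 ≤ ⨆ D, f₀ D e} ⊆ {e | c / 4 * r ^ 2 ≤ ⨆ D, f D e} := by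
    intro e he
    have h1 : ⨆ D, f₀ D e ≤ (⨆ D, f D e) - c / 4 * r ^ 2 := by
      refine ciSup_le fun D => ?_
      have h2 := le_ciSup (bdd e) ⟨D.1, Set.mem_insert_of_mem _ D.2⟩
      have h3 : c / 4 * r ^ 2 ≤ ∑ x, ∫ v, excess τ v (D.1 x) ∂(μ x) := by
        rw [← hnorm _ D.2, Finset.mul_sum]
        exact Finset.sum_le_sum fun x _ =>
          le_integral_excess hτ hτ' (hq x) (hd x) (hB _ D.2 x)
      simp only [f, Finset.sum_sub_distrib] at h2
      simp only [f₀, f, Finset.sum_sub_distrib]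
      linarith
    have h4 : 0 ≤ ⨆ D, f₀ D e := he
    change c / 4 * r ^ 2 ≤ ⨆ D, f D e
    linarith
  have markov := mul_meas_ge_le_integral_of_nonneg (Eventually.of_forall hnn) hint (c / 4 * r ^ 2)
  have h5 : (Measure.pi μ).real {e | c / 4 * r ^ 2 ≤ ⨆ D, f D e}
      ≤ 4 * signMean b / (c * r ^ 2) := by
    rw [le_div_iff₀ (by positivity)]
    have h6 := key.trans hbound
    have h7 := markov.trans h6
    linarith
  calc _ ≤ Measure.pi μ {e | c / 4 * r ^ 2 ≤ ⨆ D, f D e} := measure_mono hsub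
    _ = ENNReal.ofReal ((Measure.pi μ).real {e | c / 4 * r ^ 2 ≤ ⨆ D, f D e}) :=
      (ENNReal.ofReal_toReal (measure_ne_top _ _)).symm
    _ ≤ _ := ENNReal.ofReal_le_ofReal h5

/-! ### Common components: uniform bounds, rank and rescaling. -/

theorem common_eq_sum {p₁ p₂ T k₁ k₂ : ℕ} (θ : Param p₁ p₂ T k₁ k₂) (i : Fin p₁) (j : Fin p₂)
    (t : Fin T) : θ.common i j t = ∑ b, (∑ a, θ.R i a * θ.F t a b) * θ.C j b := by
  simp [Param.common, Matrix.mul_apply]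

theorem exists_common_bound {k₁ k₂ : ℕ} {𝓐 : Set (Fin k₁ → ℝ)} {𝓑 : Set (Fin k₂ → ℝ)}
    {𝓕 : Set (Matrix (Fin k₁) (Fin k₂) ℝ)} (h𝓐 : IsCompact 𝓐) (h𝓑 : IsCompact 𝓑)
    (h𝓕 : IsCompact 𝓕) : ∃ B : ℝ, 0 ≤ B ∧ ∀ p₁ p₂ T : ℕ, ∀ θ ∈ paramSpace 𝓐 𝓑 𝓕 p₁ p₂ T,
      ∀ i j t, |θ.common i j t| ≤ B := by
  let φ : (Fin k₁ → ℝ) × Matrix (Fin k₁) (Fin k₂) ℝ × (Fin k₂ → ℝ) → ℝ := fun y =>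
    ∑ b, (∑ a, y.1 a * y.2.1 a b) * y.2.2 b
  have hφ : Continuous φ := by
    refine continuous_finsetSum _ fun b _ => Continuous.mul (continuous_finsetSum _ fun a _ =>
      Continuous.mul ?_ ?_) ?_
    · exact (continuous_apply a).comp continuous_fst
    · exact (continuous_apply_apply a b).comp (continuous_fst.comp continuous_snd)
    · exact (continuous_apply b).comp (continuous_snd.comp continuous_snd)
  obtain ⟨B, hB⟩ := (h𝓐.prod (h𝓕.prod h𝓑)).exists_bound_of_continuousOn hφ.continuousOn
  refine ⟨max B 0, le_max_right _ _, fun p₁ p₂ T θ hθ i j t => le_max_of_le_left ?_⟩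
  rw [common_eq_sum]
  exact hB (θ.R i, θ.F t, θ.C j) ⟨hθ.1 i, hθ.2.2.1 t, hθ.2.1 j⟩

/-- The fibres of a difference of two factor structures lie in the span of both sets of loading
columns, which doubles the dimension. -/
theorem exists_fibre_subspace {α ι κ : Type*} [Fintype α] [Fintype κ] (u v : κ → α → ℝ)
    (g h : ι → κ → ℝ) : ∃ W : Submodule ℝ (EuclideanSpace ℝ α),
      Module.finrank ℝ W ≤ Fintype.card κ + Fintype.card κ ∧
      ∀ y, ∀ l : ℝ, WithLp.toLp 2 (fun i => l * (∑ a, g y a * u a i - ∑ a, h y a * v a i)) ∈ W := by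
  let U : κ → EuclideanSpace ℝ α := fun a => WithLp.toLp 2 (u a)
  let V : κ → EuclideanSpace ℝ α := fun a => WithLp.toLp 2 (v a)
  refine ⟨Submodule.span ℝ (Set.range U) ⊔ Submodule.span ℝ (Set.range V),
    (Submodule.finrank_add_le_finrank_add_finrank _ _).trans
      (add_le_add (finrank_range_le_card U) (finrank_range_le_card V)), fun y l => ?_⟩
  have : (WithLp.toLp 2 (fun i => l * (∑ a, g y a * u a i - ∑ a, h y a * v a i)) :
      EuclideanSpace ℝ α) = l • (∑ a, g y a • U a - ∑ a, h y a • V a) := by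
    ext i
    simp [U, V]
  rw [this]
  refine Submodule.smul_mem _ _ (Submodule.sub_mem _ ?_ ?_)
  · exact Submodule.mem_sup_left (Submodule.sum_mem _ fun a _ =>
      Submodule.smul_mem _ _ (Submodule.subset_span (Set.mem_range_self a)))
  · exact Submodule.mem_sup_right (Submodule.sum_mem _ fun a _ =>
      Submodule.smul_mem _ _ (Submodule.subset_span (Set.mem_range_self a)))

theorem lowRank_common_sub {p₁ p₂ T k₁ k₂ : ℕ} (θ θ' : Param p₁ p₂ T k₁ k₂) (l : ℝ) :
    LowRank (k₁ + k₁) (k₂ + k₂) fun x : Fin p₁ × Fin p₂ × Fin T =>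
      l * (θ.common x.1 x.2.1 x.2.2 - θ'.common x.1 x.2.1 x.2.2) := by
  have row : ∀ (θ : Param p₁ p₂ T k₁ k₂) i j t, θ.common i j t
      = ∑ a, (∑ b, θ.F t a b * θ.C j b) * θ.R i a := by
    intro θ i j t
    rw [common_eq_sum]
    simp_rw [Finset.sum_mul]
    rw [Finset.sum_comm]
    exact Finset.sum_congr rfl fun a _ => Finset.sum_congr rfl fun b _ => by ring
  constructor
  · obtain ⟨W, hW, h⟩ := exists_fibre_subspace (ι := Fin p₂ × Fin T) (fun a i => θ.R i a)
      (fun a i => θ'.R i a) (fun y a => ∑ b, θ.F y.2 a b * θ.C y.1 b)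
      fun y a => ∑ b, θ'.F y.2 a b * θ'.C y.1 b
    rw [Fintype.card_fin] at hW
    refine ⟨W, hW, fun j t => ?_⟩
    simp_rw [row]
    exact h (j, t) l
  · obtain ⟨W, hW, h⟩ := exists_fibre_subspace (ι := Fin p₁ × Fin T) (fun b j => θ.C j b)
      (fun b j => θ'.C j b) (fun y b => ∑ a, θ.R y.1 a * θ.F y.2 a b)
      fun y b => ∑ a, θ'.R y.1 a * θ'.F y.2 a b
    rw [Fintype.card_fin] at hW
    refine ⟨W, hW, fun i t => ?_⟩
    simp_rw [common_eq_sum]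
    exact h (i, t) l

/-- Shrinking towards 0 keeps the total excess nonpositive by convexity, so a violation at any
larger norm produces one on the sphere of radius `r`. -/
theorem exists_rescale {X : Type*} [Fintype X] {τ r : ℝ} (hr : 0 < r) {e D : X → ℝ}
    (h : ∑ x, excess τ (e x) (D x) ≤ 0) (hD : r ^ 2 ≤ ∑ x, D x ^ 2) :
    ∃ t : ℝ, 0 ≤ t ∧ t ≤ 1 ∧ ∑ x, (t * D x) ^ 2 = r ^ 2 ∧ ∑ x, excess τ (e x) (t * D x) ≤ 0 := by
  set S := ∑ x, D x ^ 2 with hS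
  have hS0 : 0 < S := lt_of_lt_of_le (by positivity) hD
  have hle : r ≤ √S := Real.le_sqrt_of_sq_le hD
  have ht0 : 0 ≤ r / √S := by positivity
  have ht1 : r / √S ≤ 1 := (div_le_one (by positivity)).2 hle
  refine ⟨r / √S, ht0, ht1, ?_, ?_⟩
  · simp_rw [mul_pow]
    rw [← Finset.mul_sum, ← hS, div_pow, Real.sq_sqrt hS0.le, div_mul_cancel₀ _ hS0.ne']
  · calc _ ≤ ∑ x, r / √S * excess τ (e x) (D x) :=
          Finset.sum_le_sum fun x _ => excess_mul_le ht0 ht1 _ _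
      _ = r / √S * ∑ x, excess τ (e x) (D x) := by rw [Finset.mul_sum]
      _ ≤ 0 := mul_nonpos_of_nonneg_of_nonpos ht0 h

/-! ### Conditioning, eigengaps, rates and the final assembly. -/

theorem measure_preimage_le_of_condDistrib {Ω β γ : Type*} [MeasurableSpace Ω]
    [MeasurableSpace β] [MeasurableSpace γ] [StandardBorelSpace γ] [Nonempty γ] {P : Measure Ω}
    [IsProbabilityMeasure P] {Y : Ω → γ} {Z : Ω → β} (hY : Measurable Y) (hZ : Measurable Z)
    {E : Set γ} (hE : MeasurableSet E) {q : ENNReal}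
    (h : ∀ᵐ z ∂(P.map Z), condDistrib Y Z P z E ≤ q) : P (Y ⁻¹' E) ≤ q := by
  have : IsProbabilityMeasure (P.map Z) := Measure.isProbabilityMeasure_map hZ.aemeasurable
  rw [← Measure.map_apply hY hE, ← condDistrib_comp_map hZ.aemeasurable hY.aemeasurable,
    Measure.bind_apply hE (Kernel.aemeasurable _)]
  calc _ ≤ ∫⁻ _z, q ∂(P.map Z) := lintegral_mono_ae h
    _ = q := by simp

/-- The factor 3 leaves a gap `g` after each entry moves by less than `g`, as used in
`gap_of_close`. -/
theorem exists_gap {k : ℕ} {σ : Fin k → ℝ} (hσ : StrictAnti σ) (hpos : ∀ a, 0 < σ a) :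
    ∃ g : ℝ, 0 < g ∧ (∀ a b, a < b → σ b + 3 * g ≤ σ a) ∧ ∀ a, 3 * g ≤ σ a := by
  have small : ∀ x : ℝ, 0 < x → ∀ᶠ g : ℝ in nhdsWithin 0 (Set.Ioi 0), 3 * g ≤ x := by
    intro x hx
    filter_upwards [Ioo_mem_nhdsGT (show (0 : ℝ) < x / 3 by positivity)] with g hg
    linarith [hg.2]
  have h1 : ∀ᶠ g : ℝ in nhdsWithin 0 (Set.Ioi 0), ∀ a b, a < b → 3 * g ≤ σ a - σ b := by
    simp only [eventually_all]
    exact fun a b hab => small _ (sub_pos.2 (hσ hab))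
  have h2 : ∀ᶠ g : ℝ in nhdsWithin 0 (Set.Ioi 0), ∀ a, 3 * g ≤ σ a :=
    eventually_all.2 fun a => small _ (hpos a)
  obtain ⟨g, ⟨h3, h4⟩, h5⟩ := ((h1.and h2).and self_mem_nhdsWithin).exists
  exact ⟨g, h5, fun a b hab => by linarith [h3 a b hab], h4⟩

/-- Convergence in probability of finitely many sequences makes the probability that one of them
is far from its limit eventually small. -/
theorem eventually_measure_exists_far_le {Ω ι κ : Type*} [MeasurableSpace Ω] [Fintype κ]
    {P : Measure Ω} {l : Filter ι} {f : κ → ι → Ω → ℝ} {σ : κ → ℝ}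
    (h : ∀ a, TendstoInMeasure P (f a) l fun _ => σ a) {g : ℝ} (hg : 0 < g) {q : ENNReal}
    (hq : 0 < q) : ∀ᶠ n in l, P {ω | ∃ a, g ≤ |f a n ω - σ a|} ≤ q := by
  have h1 : Tendsto (fun n => ∑ a, P {ω | g ≤ |f a n ω - σ a|}) l (nhds 0) := by
    rw [← Finset.sum_const_zero (s := (Finset.univ : Finset κ))]
    refine tendsto_finsetSum _ fun a _ => ?_
    have := tendstoInMeasure_iff_dist.1 (h a) g hg
    simpa only [Real.dist_eq] using this
  filter_upwards [h1.eventually (gt_mem_nhds hq)] with n hn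
  rw [Set.ofPred_exists]
  exact (measure_iUnion_fintype_le _ _).trans hn.le

theorem gap_of_close {k : ℕ} {σ s : Fin k → ℝ} {g : ℝ} (hgap : ∀ a b, a < b → σ b + 3 * g ≤ σ a)
    (hpos : ∀ a, 3 * g ≤ σ a) (h : ∀ a, |s a - σ a| < g) :
    (∀ a b, a < b → s b + g ≤ s a) ∧ ∀ a, g ≤ s a := by
  refine ⟨fun a b hab => ?_, fun a => ?_⟩
  · have h1 := abs_lt.1 (h a)
    have h2 := abs_lt.1 (h b)
    linarith [hgap a b hab, h1.1, h2.2]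
  · have h1 := abs_lt.1 (h a)
    linarith [hpos a, h1.1, (abs_nonneg (s a - σ a)).trans_lt (h a)]

theorem rateL_pos {p₁ p₂ T : ℕ} (hp₁ : 0 < p₁) (hp₂ : 0 < p₂) (hT : 0 < T) :
    0 < rateL p₁ p₂ T := by
  unfold rateL
  have h1 : (0 : ℝ) < p₁ := by exact_mod_cast hp₁
  have h2 : (0 : ℝ) < p₂ := by exact_mod_cast hp₂
  have h3 : (0 : ℝ) < T := by exact_mod_cast hT
  exact lt_min (by positivity) (lt_min (by positivity) (by positivity))

/-- L² is at most each of p₁p₂, p₂T and p₁T; multiplying by the missing size and adding gives (p₁ +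
p₂ + T)L² ≤ 3p₁p₂T, and 3 ≤ 2². -/
theorem dimension_le_mul_rate {p₁ p₂ T : ℕ} (hp₁ : 0 < p₁) (hp₂ : 0 < p₂) (hT : 0 < T) :
    ((p₁ : ℝ) + p₂ + T) ≤ p₁ * p₂ * T * (2 / rateL p₁ p₂ T) ^ 2 := by
  have hL := rateL_pos hp₁ hp₂ hT
  have sq : ∀ a b : ℕ, rateL p₁ p₂ T ≤ √((a : ℝ) * b) → rateL p₁ p₂ T ^ 2 ≤ a * b := by
    intro a b h
    calc _ ≤ √((a : ℝ) * b) ^ 2 := by gcongr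
      _ = _ := Real.sq_sqrt (by positivity)
  have h1 := sq p₁ p₂ (min_le_left _ _)
  have h2 := sq p₂ T ((min_le_right _ _).trans (min_le_left _ _))
  have h3 := sq p₁ T ((min_le_right _ _).trans (min_le_right _ _))
  rw [div_pow, mul_div_assoc', le_div_iff₀ (by positivity)]
  have h4 := mul_le_mul_of_nonneg_left h1 (Nat.cast_nonneg (α := ℝ) T)
  have h5 := mul_le_mul_of_nonneg_left h2 (Nat.cast_nonneg (α := ℝ) p₁)
  have h6 := mul_le_mul_of_nonneg_left h3 (Nat.cast_nonneg (α := ℝ) p₂)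
  have h7 : (0 : ℝ) ≤ p₁ * p₂ * T := by positivity
  linarith

/-- The sphere has radius K√n with n = p₁ + p₂ + T. Complexity and curvature give the ratio of 4 · m
· K√n · 20√n to c · K²n, where m = √(2k₁ · 2k₂): the sizes cancel, leaving 80m/(cK). -/
theorem exists_exceptional_event {p₁ p₂ T : ℕ} (hp₁ : 0 < p₁) (hp₂ : 0 < p₂) (hT : 0 < T)
    (k₁ k₂ : ℕ) {τ : ℝ} (hτ : 0 ≤ τ) (hτ' : τ ≤ 1) (B : ℝ) {K : ℝ} (hK : 0 < K) :
    ∃ E : Set (Fin p₁ × Fin p₂ × Fin T → ℝ), MeasurableSet E ∧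
      (∀ (θ θ' : Param p₁ p₂ T k₁ k₂) e,
        (∀ i j t, |θ.common i j t - θ'.common i j t| ≤ B) →
        ∑ x, excess τ (e x) (θ.common x.1 x.2.1 x.2.2 - θ'.common x.1 x.2.1 x.2.2) ≤ 0 →
        e ∉ E → ∑ x : Fin p₁ × Fin p₂ × Fin T,
          (θ.common x.1 x.2.1 x.2.2 - θ'.common x.1 x.2.1 x.2.2) ^ 2 ≤ K ^ 2 * (p₁ + p₂ + T)) ∧
      ∀ (μ : Fin p₁ × Fin p₂ × Fin T → Measure ℝ) [∀ x, IsProbabilityMeasure (μ x)] (c : ℝ),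
        0 < c → (∀ x, μ x (Set.Iic 0) = ENNReal.ofReal τ) →
        (∀ x a b, -B ≤ a → a ≤ b → b ≤ B →
          ENNReal.ofReal (c * (b - a)) ≤ μ x (Set.Ioc a b)) →
        Measure.pi μ E
          ≤ ENNReal.ofReal (80 * √((k₁ + k₁ : ℕ) * (k₂ + k₂ : ℕ)) / (c * K)) := by
  have hn : (0 : ℝ) < p₁ + p₂ + T := by positivity
  have : Nonempty (Fin p₁) := ⟨⟨0, hp₁⟩⟩
  have : Nonempty (Fin p₂) := ⟨⟨0, hp₂⟩⟩
  have : Nonempty (Fin T) := ⟨⟨0, hT⟩⟩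
  obtain ⟨b₀, hb₀, hmean⟩ := exists_spectralBound (p₁ := p₁) (p₂ := p₂) (T := T) (by omega)
  set n : ℝ := p₁ + p₂ + T with hndef
  set m : ℝ := √((k₁ + k₁ : ℕ) * (k₂ + k₂ : ℕ)) with hm
  set r : ℝ := K * √n with hr
  have hr0 : 0 < r := by positivity
  have hrsq : r ^ 2 = K ^ 2 * n := by rw [hr, mul_pow, Real.sq_sqrt hn.le]
  let 𝒟 : Set (Fin p₁ × Fin p₂ × Fin T → ℝ) :=
    {D | (∀ x, |D x| ≤ B) ∧ ∑ x, D x ^ 2 = r ^ 2 ∧ LowRank (k₁ + k₁) (k₂ + k₂) D}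
  obtain ⟨E, hE, hsup, hprob⟩ := exists_measurable_superset hτ hτ' 𝒟 hr0 (fun D hD => hD.1)
    (fun D hD => hD.2.1) (b := fun s => m * r * b₀ s)
    (fun s => mul_nonneg (by positivity) (hb₀ s).nonneg) (fun D hD s => by
      have := hD.2.2.sum_mul_le (hb₀ s).nonneg (hb₀ s)
      rwa [hD.2.1, Real.sqrt_sq hr0.le] at this)
  refine ⟨E, hE, fun θ θ' e hΔ hloss he => ?_, fun μ _ c hc hq hd => ?_⟩
  · by_contra! hcon
    rw [← hrsq] at hcon
    obtain ⟨l, hl0, hl1, hl, hl'⟩ := exists_rescale hr0 hloss hcon.le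
    refine he (hsup e ⟨_, ⟨fun x => ?_, hl, lowRank_common_sub θ θ' l⟩, hl'⟩)
    rw [abs_mul, abs_of_nonneg hl0]
    exact (mul_le_of_le_one_left (abs_nonneg _) hl1).trans (hΔ _ _ _)
  · refine (hprob μ c hc hq hd).trans (ENNReal.ofReal_le_ofReal ?_)
    rw [signMean_mul_left]
    calc 4 * (m * r * signMean b₀) / (c * r ^ 2) ≤ 4 * (m * r * (20 * √n)) / (c * r ^ 2) := by
          gcongr
      _ = 80 * m / (c * K) := by
          rw [hr]
          have : √n ≠ 0 := by positivity
          field_simp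
          ring

theorem ofReal_mul_sub_le_withDensity_Ioc {f : ℝ → ℝ} {c B : ℝ} (hf : ∀ u ∈ Set.Icc (-B) B, c ≤ f u)
    {a b : ℝ} (ha : -B ≤ a) (hb : b ≤ B) (hc : 0 ≤ c) :
    ENNReal.ofReal (c * (b - a))
      ≤ volume.withDensity (fun u => ENNReal.ofReal (f u)) (Set.Ioc a b) := by
  rw [withDensity_apply _ measurableSet_Ioc, ENNReal.ofReal_mul hc, ← Real.volume_Ioc,
    ← setLIntegral_const]
  exact setLIntegral_mono' measurableSet_Ioc fun u hu =>
    ENNReal.ofReal_le_ofReal (hf u ⟨ha.trans hu.1.le, hu.2.trans hb⟩)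

theorem sum_excess_nonpos {p₁ p₂ T k₁ k₂ : ℕ} (hp₁ : 0 < p₁) (hp₂ : 0 < p₂) (hT : 0 < T) {τ : ℝ}
    {θ θ₀ : Param p₁ p₂ T k₁ k₂} {e : Fin p₁ × Fin p₂ × Fin T → ℝ}
    (h : empiricalLoss τ (fun x => θ₀.common x.1 x.2.1 x.2.2 + e x) θ
      ≤ empiricalLoss τ (fun x => θ₀.common x.1 x.2.1 x.2.2 + e x) θ₀) :
    ∑ x, excess τ (e x) (θ.common x.1 x.2.1 x.2.2 - θ₀.common x.1 x.2.1 x.2.2) ≤ 0 := by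
  unfold empiricalLoss at h
  have h1 := le_of_mul_le_mul_left h (by positivity)
  simp_rw [excess, Finset.sum_sub_distrib, Fintype.sum_prod_type]
  rw [sub_nonpos]
  have e1 : ∀ i j t, e (i, j, t) - (θ.common i j t - θ₀.common i j t)
      = θ₀.common i j t + e (i, j, t) - θ.common i j t := fun i j t => by ring
  simp only [add_sub_cancel_left] at h1
  simpa only [e1] using h1

/-- The aligned quantile regression estimator converges at the rate `1 / L`. -/
theorem Regular.isBigOP_error {Ω : Type*} [MeasurableSpace Ω] {P : Measure Ω}
    [IsProbabilityMeasure P] {k₁ k₂ : ℕ} {τ : ℝ} (hτ : 0 < τ) (hτ' : τ < 1)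
    {𝓐 : Set (Fin k₁ → ℝ)} {𝓑 : Set (Fin k₂ → ℝ)} {𝓕 : Set (Matrix (Fin k₁) (Fin k₂) ℝ)}
    {M : Model Ω k₁ k₂} (hM : M.Regular P τ 𝓐 𝓑 𝓕)
    {θhat : ∀ p₁ p₂ T : ℕ, Ω → Param p₁ p₂ T k₁ k₂} (hθ : M.IsQREstimator P τ 𝓐 𝓑 𝓕 θhat) :
    IsBigOP P
      (fun p₁ p₂ T ω => ((θhat p₁ p₂ T ω).align (M.θ₀ p₁ p₂ T ω)).error (M.θ₀ p₁ p₂ T ω))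
      (fun p₁ p₂ T => 1 / rateL p₁ p₂ T) := by
  obtain ⟨B, hB0, hB⟩ := exists_common_bound hM.isCompact_row hM.isCompact_col hM.isCompact_factor
  obtain ⟨f, -, hf, hflow⟩ := hM.density
  -- Differences of two common components are bounded by `2 * B`, so the densities matter only on
  -- this interval.
  obtain ⟨c, hc, hfc⟩ := hflow (Set.Icc (-(2 * B)) (2 * B)) isCompact_Icc
  obtain ⟨σ, hσ, hσpos, hσlim⟩ := hM.row_spectrum
  obtain ⟨σ', hσ', hσpos', hσlim'⟩ := hM.col_spectrum
  obtain ⟨g₁, hg₁, hgap₁, hpos₁⟩ := exists_gap hσ hσpos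
  obtain ⟨g₂, hg₂, hgap₂, hpos₂⟩ := exists_gap hσ' hσpos'
  set g := min g₁ g₂ with hgdef
  have hg : 0 < g := lt_min hg₁ hg₂
  have hgle₁ : g ≤ g₁ := min_le_left _ _
  have hgle₂ : g ≤ g₂ := min_le_right _ _
  intro η hη
  set m : ℝ := √((k₁ + k₁ : ℕ) * (k₂ + k₂ : ℕ)) with hm
  -- Chosen so that 80m/(cK) ≤ η/3; the summand 1 keeps `K` positive when `m = 0`, that is, when
  -- `k₁` or `k₂` is 0.
  set K : ℝ := 240 * m / (c * η) + 1 with hKdef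
  have hK : 0 < K := by positivity
  have hKη : 80 * m / (c * K) ≤ η / 3 := by
    rw [div_le_iff₀ (by positivity)]
    have : η / 3 * (c * K) = 80 * m + η / 3 * c := by rw [hKdef]; field_simp; ring
    rw [this]
    have : 0 ≤ η / 3 * c := by positivity
    linarith
  have hη3 : (0 : ENNReal) < ENNReal.ofReal (η / 3) := ENNReal.ofReal_pos.2 (by positivity)
  refine ⟨errorConst k₁ k₂ B g * (K * 2), ?_⟩
  filter_upwards [eventually_ge_atTop (1, 1, 1), hM.measurable_factor, hM.measurable_error,
    hM.true_mem, hM.quantile, hf, hM.indep, hθ,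
    eventually_measure_exists_far_le hσlim hg hη3,
    eventually_measure_exists_far_le hσlim' hg hη3] with
    ⟨p₁, p₂, T⟩ hn hmF hmε htrue hquant hdens hindep hest hfar hfar'
  obtain ⟨hp₁, hp₂, hT⟩ : 0 < p₁ ∧ 0 < p₂ ∧ 0 < T := ⟨hn.1, hn.2.1, hn.2.2⟩
  dsimp only at *
  obtain ⟨E, hE, hEbound, hEprob⟩ :=
    exists_exceptional_event hp₁ hp₂ hT k₁ k₂ hτ.le hτ'.le (2 * B) hK
  have hPE : P (M.ε p₁ p₂ T ⁻¹' E) ≤ ENNReal.ofReal (η / 3) := by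
    refine measure_preimage_le_of_condDistrib hmε hmF hE ?_
    filter_upwards [hindep, ae_all_iff.2 hquant, ae_all_iff.2 hdens] with F h1 h2 h3
    rw [h1]
    refine (hEprob _ c hc h2 fun x a b ha _ hb => ?_).trans (ENNReal.ofReal_le_ofReal hKη)
    rw [h3 x]
    exact ofReal_mul_sub_le_withDensity_Ioc (fun u hu => hfc _ _ _ _ _ u hu) ha hb hc.le
  have hnull : P {ω | ¬(M.θ₀ p₁ p₂ T ω ∈ paramSpace 𝓐 𝓑 𝓕 p₁ p₂ T ∧
      θhat p₁ p₂ T ω ∈ paramSpace 𝓐 𝓑 𝓕 p₁ p₂ T ∧ ∀ θ ∈ paramSpace 𝓐 𝓑 𝓕 p₁ p₂ T,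
        empiricalLoss τ (M.X p₁ p₂ T ω) (θhat p₁ p₂ T ω)
          ≤ empiricalLoss τ (M.X p₁ p₂ T ω) θ)} = 0 :=
    ae_iff.1 (htrue.and hest)
  -- The failure set, possibly nonmeasurable, is covered by a null set, the exceptional event and
  -- the two events of a bad spectrum; each of the last three has measure at most η/3.
  refine (measure_mono (t := {ω | ¬(M.θ₀ p₁ p₂ T ω ∈ paramSpace 𝓐 𝓑 𝓕 p₁ p₂ T ∧
      θhat p₁ p₂ T ω ∈ paramSpace 𝓐 𝓑 𝓕 p₁ p₂ T ∧ ∀ θ ∈ paramSpace 𝓐 𝓑 𝓕 p₁ p₂ T,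
        empiricalLoss τ (M.X p₁ p₂ T ω) (θhat p₁ p₂ T ω)
          ≤ empiricalLoss τ (M.X p₁ p₂ T ω) θ)} ∪ (M.ε p₁ p₂ T ⁻¹' E ∪
      ({ω | ∃ a, g ≤ |rowGram (M.θ₀ p₁ p₂ T ω).F a a - σ a|} ∪
        {ω | ∃ a, g ≤ |colGram (M.θ₀ p₁ p₂ T ω).F a a - σ' a|})) ) ?_).trans ?_
  · intro ω hω
    by_contra hnot
    simp only [Set.mem_union, Set.mem_ofPred_eq, Set.mem_preimage, not_or, not_not, not_exists,
      not_le] at hnot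
    obtain ⟨⟨hmem₀, hmem, hmin⟩, hωE, hrow, hcol⟩ := hnot
    have gap₁ := gap_of_close (g := g) (fun a b hab => by linarith [hgap₁ a b hab])
      (fun a => by linarith [hpos₁ a]) hrow
    have gap₂ := gap_of_close (g := g) (fun a b hab => by linarith [hgap₂ a b hab])
      (fun a => by linarith [hpos₂ a]) hcol
    have bd := hB p₁ p₂ T _ hmem
    have bd₀ := hB p₁ p₂ T _ hmem₀
    have hL := rateL_pos hp₁ hp₂ hT
    have hsq := hEbound (θhat p₁ p₂ T ω) (M.θ₀ p₁ p₂ T ω) (M.ε p₁ p₂ T ω)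
      (fun i j t => (abs_sub _ _).trans (by linarith [bd i j t, bd₀ i j t]))
      (sum_excess_nonpos hp₁ hp₂ hT (hmin _ hmem₀)) hωE
    have herr := error_align_le hp₁ hp₂ hT hmem hmem₀ (d := K * (2 / rateL p₁ p₂ T)) hg hB0
      (by positivity) gap₁.1 gap₁.2 gap₂.1 gap₂.2 bd bd₀ (hsq.trans (by
        have := mul_le_mul_of_nonneg_left (dimension_le_mul_rate hp₁ hp₂ hT) (sq_nonneg K)
        linarith))
    have hnn : 0 ≤ ((θhat p₁ p₂ T ω).align (M.θ₀ p₁ p₂ T ω)).error (M.θ₀ p₁ p₂ T ω) := by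
      unfold Param.error; positivity
    rw [Set.mem_ofPred_eq, abs_of_nonneg hnn] at hω
    refine absurd hω (not_lt.2 ?_)
    refine herr.trans (le_of_eq ?_)
    ring
  · refine (measure_union_le _ _).trans ?_
    rw [hnull, zero_add]
    refine (measure_union_le _ _).trans ((add_le_add hPE ((measure_union_le _ _).trans
      (add_le_add hfar hfar'))).trans (le_of_eq ?_))
    rw [← ENNReal.ofReal_add (by positivity) (by positivity),
      ← ENNReal.ofReal_add (by positivity) (by positivity)]
    congr 1
    ring

end MatrixQuantileFactor

theorem theorem3p2 {Ω : Type*} [MeasurableSpace Ω] (P : MeasureTheory.Measure Ω)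
    [MeasureTheory.IsProbabilityMeasure P] (k₁ k₂ : ℕ) (τ : ℝ) (hτ : 0 < τ) (hτ' : τ < 1)
    (𝓐 : Set (Fin k₁ → ℝ)) (𝓑 : Set (Fin k₂ → ℝ)) (𝓕 : Set (Matrix (Fin k₁) (Fin k₂) ℝ))
    (M : MatrixQuantileFactor.Model Ω k₁ k₂) (hM : M.Regular P τ 𝓐 𝓑 𝓕)
    (θhat : ∀ p₁ p₂ T : ℕ, Ω → MatrixQuantileFactor.Param p₁ p₂ T k₁ k₂)
    (hθ : M.IsQREstimator P τ 𝓐 𝓑 𝓕 θhat) :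
    MatrixQuantileFactor.IsBigOP P
      (fun p₁ p₂ T ω =>
        ((θhat p₁ p₂ T ω).align (M.θ₀ p₁ p₂ T ω)).error (M.θ₀ p₁ p₂ T ω))
      (fun p₁ p₂ T => 1 / MatrixQuantileFactor.rateL p₁ p₂ T) :=
  MatrixQuantileFactor.Regular.isBigOP_error hτ hτ' hM hθ
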